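/- Theorem (modified flow of $n$-layer Lookahead). Let $\ell_s:\mathbb R^d\to\mathbb R$ be the $C^3$ losses of $N=mb$ samples $s$, where $m,b\ge 1$. In each epoch the samples are split uniformly at random into $m$ mini-batches $0,\dots,m-1$ of $b$ samples each, so that each sample belongs to exactly one mini-batch; $\mathbb E$ denotes the mean over this splitting. Let $f=\frac1N\sum_s\ell_s$, let $f_i$ be the average of the losses of the samples in mini-batch $i$, and put $$AN(y)=\mathbb E\|\nabla f_0(y)\|^2,\qquad AI(y)=\mathbb E\langle\nabla f_0(y),\nabla f_1(y)\rangle$$ (for $m=1$ put $AI=0$; its coefficient below is then $0$). Let $n\ge 0$, $\alpha_1,\dots,\alpha_n\in[0,1]$, and let $k_1,\dots,k_n$ be positive integers with $k_1\cdots k_n\mid m$. $n$-layer Lookahead with SGD of learning rate $\gamma>0$ as inner optimizer is defined recursively: a round of the $0$-layer optimizer is an SGD step $x\mapsto x-\gamma\nabla f_t(x)$, where $t=0,1,\dots,m-1$ is the number of the iteration in the epoch; a round of the $p$-layer optimizer ($1\le p\le n$) from $y$ performs $k_p$ successive rounds of the $(p-1)$-layer optimizer from $y$, with result $x$, and returns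 $(1-\alpha_p)y+\alpha_p x$. Let $y_r$ be the output of the $n$-layer optimizer from $y_0$ after one epoch, that is, after $r=m/(k_1\cdots k_n)$ rounds. Put $\beta=\alpha_1\cdots\alpha_n$ and $$P_\gamma(y)=f(y)+\frac{\gamma\,\alpha_1\cdots\alpha_n}{4}AN(y)-\frac{\gamma}{4}\sum_{p=1}^n(1-\alpha_p)\alpha_{p-1}\cdots\alpha_1\,(k_p\cdots k_1-1)\,AI(y).$$ For a family $(\tilde f_\gamma)_{\gamma>0}$ of $C^2$ functions on $\mathbb R^d$ write $\tilde f_\gamma=P_\gamma+\mathcal O(\gamma^2)$ if for every compact $K\subset\mathbb R^d$ there is $C$ such that, for all sufficiently small $\gamma>0$, $|\tilde f_\gamma-P_\gamma|\le C\gamma^2$ and $\|\nabla\tilde f_\gamma-\nabla P_\gamma\|\le C\gamma^2$ on $K$. (1) Let $\tilde f_\gamma=P_\gamma+\mathcal O(\gamma^2)$ and let $K\subset\mathbb R^d$ be compact. Then there is $C$ such that for all sufficiently small $\gamma>0$ and all $y_0\in K$ the problem $\dot y=-\nabla\tilde f_\gamma(y)$, $y(0)=y_0$ has a solution on $[0,\beta\gamma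 m]$, and every such solution satisfies $$\|y(\alpha_1\cdots\alpha_n\gamma m)-\mathbb E[y_r]\|\le C\gamma^3 .$$ (2) For every $y_0\in\mathbb R^d$ the $\mathcal O(\gamma^2)$ term can be chosen such that equality holds: there is a family $\tilde f_\gamma=P_\gamma+\mathcal O(\gamma^2)$ (which may depend on $y_0$) such that for all sufficiently small $\gamma>0$ the problem $\dot y=-\nabla\tilde f_\gamma(y)$, $y(0)=y_0$ has a solution on $[0,\beta\gamma m]$ with $y(\alpha_1\cdots\alpha_n\gamma m)=\mathbb E[y_r]$. -/

import Mathlib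

open Filter Topology Set

noncomputable section

namespace Lookahead

section Optimizer

variable {E : Type*} [AddCommGroup E] [Module ℝ E]

/-- `runRounds step len t r y`: perform `r` consecutive rounds from the point `y`. A round takes
`len` iterations; `step s x` is the result of one round that starts at iteration number `s` from
the point `x`. The first round starts at iteration number `t`. -/
def runRounds (step : ℕ → E → E) (len t : ℕ) : ℕ → E → E
  | 0, y => y
  | i + 1, y => step (t + i * len) (runRounds step len t i y)

/-- One round of the multilayer Lookahead optimizer with SGD as base optimizer:
`round g γ k α n t y` starts at iteration number `t` from the (outer) point `y`; iteration `s` uses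
the stochastic gradient field `g s`. Layers are counted from the inside and from `0`, so that the
parameters `k_{p+1}`, `α_{p+1}` of the usual notation are `k p`, `α p`. With `0` layers this is an
SGD step; a round with `n + 1` layers performs `k n` rounds of the `n`-layer optimizer and then
synchronizes. -/
def round (g : ℕ → E → E) (γ : ℝ) (k : ℕ → ℕ) (α : ℕ → ℝ) : ℕ → ℕ → E → E
  | 0, t, y => y - γ • g t y
  | n + 1, t, y =>
      (1 - α n) • y +
        α n • runRounds (round g γ k α n) (∏ q ∈ Finset.range n, k q) t (k n) y

/-- The output `y_r` of `n`-layer Lookahead after `r` rounds, started at `y` (iteration number `0`).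
-/
def output (g : ℕ → E → E) (γ : ℝ) (k : ℕ → ℕ) (α : ℕ → ℝ) (n r : ℕ) (y : E) : E :=
  runRounds (round g γ k α n) (∏ q ∈ Finset.range n, k q) 0 r y

end Optimizer

section Loss

variable {ι : Type*} [Fintype ι] [DecidableEq ι]

/-- Mean over the randomness of a reshuffling. A reshuffling of the samples `ι` into `m`
mini-batches of `b` samples is a bijection `σ : ι ≃ Fin m × Fin b`, whose first component is the
number of the mini-batch that contains the sample; all reshufflings are equally likely. -/
def shuffleMean {V : Type*} [AddCommGroup V] [Module ℝ V] {m b : ℕ}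
    (X : (ι ≃ Fin m × Fin b) → V) : V :=
  (Fintype.card (ι ≃ Fin m × Fin b) : ℝ)⁻¹ • ∑ σ, X σ

variable {E : Type*}

/-- The full loss `f`: the average of the losses of all samples. -/
def fullLoss (loss : ι → E → ℝ) (y : E) : ℝ :=
  (Fintype.card ι : ℝ)⁻¹ * ∑ s, loss s y

/-- The loss `f_t` of mini-batch number `t` (`0 ≤ t < m`): the average of the losses of its `b`
samples. -/
def batchLoss (loss : ι → E → ℝ) {m b : ℕ} (σ : ι ≃ Fin m × Fin b) (t : ℕ) (y : E) : ℝ :=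
  (b : ℝ)⁻¹ * ∑ s with ((σ s).1 : ℕ) = t, loss s y

variable [NormedAddCommGroup E] [InnerProductSpace ℝ E] [CompleteSpace E]

/-- `AN(y) = 𝔼 ‖∇f_0(y)‖²`. -/
def AN (loss : ι → E → ℝ) (m b : ℕ) (y : E) : ℝ :=
  shuffleMean fun σ : ι ≃ Fin m × Fin b => ‖gradient (batchLoss loss σ 0) y‖ ^ 2

/-- `AI(y) = 𝔼 ⟨∇f_0(y), ∇f_1(y)⟩`. For `m = 1` there is no mini-batch number `1`, and the value is
`0`; the coefficient of `AI` in `modifiedLoss` then vanishes as well. -/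
def AI (loss : ι → E → ℝ) (m b : ℕ) (y : E) : ℝ :=
  shuffleMean fun σ : ι ≃ Fin m × Fin b =>
    inner ℝ (gradient (batchLoss loss σ 0) y) (gradient (batchLoss loss σ 1) y)

/-- The mean `𝔼[y_r]` of the iterate at the end of one epoch of `n`-layer Lookahead, which
consists of `r = m / (k_1 ⋯ k_n)` rounds. -/
def meanEpochOutput (loss : ι → E → ℝ) (m b : ℕ) (γ : ℝ) (k : ℕ → ℕ) (α : ℕ → ℝ) (n : ℕ)
    (y : E) : E :=
  shuffleMean fun σ : ι ≃ Fin m × Fin b =>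
    output (fun t => gradient (batchLoss loss σ t)) γ k α n (m / ∏ q ∈ Finset.range n, k q) y

/-- The explicit part of the modified loss:
`f + (γ α_1⋯α_n / 4) AN - (γ / 4) ∑_{p=1}^n (1 - α_p) α_{p-1}⋯α_1 (k_p⋯k_1 - 1) AI`. -/
def modifiedLoss (loss : ι → E → ℝ) (m b : ℕ) (k : ℕ → ℕ) (α : ℕ → ℝ) (n : ℕ) (γ : ℝ)
    (y : E) : ℝ :=
  fullLoss loss y + γ * (∏ q ∈ Finset.range n, α q) / 4 * AN loss m b y
    - γ / 4 * (∑ p ∈ Finset.range n, (1 - α p) * (∏ q ∈ Finset.range p, α q) *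
        ((∏ q ∈ Finset.range (p + 1), (k q : ℝ)) - 1)) * AI loss m b y

end Loss

section Flow

variable {E : Type*} [NormedAddCommGroup E] [InnerProductSpace ℝ E] [CompleteSpace E]

/-- `F γ = P γ + O(γ²)` as `γ → 0⁺`, for families of potentials of class `C²`: the values and the
gradients (which drive the flow) agree up to `O(γ²)`, uniformly on compact sets. -/
def EqUpToSq (F P : ℝ → E → ℝ) : Prop :=
  (∀ γ > 0, ContDiff ℝ 2 (F γ)) ∧
  ∀ K : Set E, IsCompact K → ∃ C : ℝ, ∀ᶠ γ in 𝓝[>] (0 : ℝ), ∀ y ∈ K,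
    |F γ y - P γ y| ≤ C * γ ^ 2 ∧ ‖gradient (F γ) y - gradient (P γ) y‖ ≤ C * γ ^ 2

/-- `y` solves `ẏ = -∇F(y)`, `y(0) = y₀` on the time interval `[0, T]`. -/
def IsGradientFlow (F : E → ℝ) (y₀ : E) (T : ℝ) (y : ℝ → E) : Prop :=
  y 0 = y₀ ∧ ∀ t ∈ Icc 0 T, HasDerivWithinAt y (-gradient F (y t)) (Icc 0 T) t

end Flow

end Lookahead

end

/-!
Both the mean epoch output and the time-`βγm` map of the modified flow are compared with their
expansions `y - γ A(y) + γ² B(y) + O(γ³)`. Write `β` for the product of the `α q`.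

*Discrete side.* Maps with such an expansion (`HasExpansion`) are closed under composition, the
second-order terms adding up together with `DA'(y) A(y)`, under the Lookahead update
`(1 - α) y + α Φ(y)`, and under averages. Hence an epoch along fixed mini-batches has first-order
coefficient `β ∑ g_t = β m ∇f`, where `g_t = ∇f_t`, and second-order coefficient a weighted sum of
the interactions `Dg_s g_{s'}` over pairs `s' < s` (`HasExpansion.output`). The mini-batches are
exchangeable, so that every pair of distinct iterations has the same mean interaction
`W = 𝔼[Dg_0 g_1]`, and only the total weight of the pairs matters. It is computed by recursion on
the layers (`sum_roundPairSum`) and equals `β m (S + β (m - 1)) / 2`, where `-(γ / 4) S` is the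
coefficient of `AI` in the modified loss.

*Continuous side.* The flow of `-(G + γ H + O(γ²))` over the time `τγ` has first-order coefficient
`τ G` and second-order coefficient `(τ² / 2) DG G - τ H` (`exists_flow_expansion`). Here `G = ∇f`
and `τ = β m`. Since Hessians are symmetric, `∇AI = 2 W` and `∇AN = 2 N` with `N = 𝔼[Dg_0 g_0]`,
while `DG G = (N + (m - 1) W) / m`. With these values `N` cancels and the two second-order
coefficients agree (`second_order_eq`), which gives the `O(γ³)` estimate.

*Exactness.* The remaining error is `O(γ³)`, and adding a linear function `γ² ⟨c, y⟩` to the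
modified loss moves the end point of the flow by approximately `-γ² (β γ m) c`. For small `γ` the
equation for `c` is a fixed-point equation with contraction rate `1 / 2` on a fixed ball
(`exists_flow_eq_target`). If `β = 0`, some layer resets every iterate, the flow runs for no time,
and both sides equal `y₀`.
-/

namespace Lookahead

/-! ### Second-order expansions in the learning rate -/

section Expansion

open Asymptotics

variable {E : Type*} [NormedAddCommGroup E]

lemma tendsto_learningRate (p : E) :
    Tendsto (fun q : ℝ × E => q.1) (𝓝[>] (0 : ℝ) ×ˢ 𝓝 p) (𝓝 0) :=
  (tendsto_nhdsWithin_iff.1 tendsto_id).1.comp tendsto_fst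

/-- Lower powers of the learning rate dominate higher ones. -/
lemma isBigO_pow {i j : ℕ} (hij : i ≤ j) (p : E) :
    (fun q : ℝ × E => q.1 ^ j) =O[𝓝[>] (0 : ℝ) ×ˢ 𝓝 p] fun q => q.1 ^ i := by
  obtain ⟨c, rfl⟩ := Nat.exists_eq_add_of_le hij
  have := ((tendsto_learningRate p).pow c).isBigO_one ℝ
  simpa [pow_add] using (isBigO_refl (fun q : ℝ × E => q.1 ^ i) _).mul this

lemma isBigO_of_continuous {f : E → E} (hf : Continuous f) (p : E) :
    (fun q : ℝ × E => f q.2) =O[𝓝[>] (0 : ℝ) ×ˢ 𝓝 p] fun _ => (1 : ℝ) :=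
  ((hf.tendsto p).comp tendsto_snd).isBigO_one ℝ

variable [NormedSpace ℝ E]

/-- First-order Taylor formula with quadratic remainder. -/
lemma norm_sub_sub_fderiv_le {f : E → E} (hf : Differentiable ℝ f) {s : Set E} (hs : Convex ℝ s)
    {K : NNReal} (hK : LipschitzOnWith K (fderiv ℝ f) s) {x y : E} (hx : x ∈ s) (hy : y ∈ s) :
    ‖f y - f x - fderiv ℝ f x (y - x)‖ ≤ K * ‖y - x‖ ^ 2 := by
  have hseg : segment ℝ x y ⊆ s := hs.segment_subset hx hy
  have := (convex_segment x y).norm_image_sub_le_of_norm_fderiv_le' (𝕜 := ℝ) (f := f)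
    (φ := fderiv ℝ f x) (C := K * ‖y - x‖) (fun z _ => hf z) (fun z hz => by
      refine (hK.norm_sub_le (hseg hz) hx).trans ?_
      gcongr
      have := norm_sub_le_of_mem_segment hz
      simpa using this)
    (left_mem_segment ℝ x y) (right_mem_segment ℝ x y)
  exact this.trans_eq (by ring)

lemma isBigO_sub_of_contDiff_one {f : E → E} (hf : ContDiff ℝ 1 f) (p : E) :
    (fun q : E × E => f q.2 - f q.1) =O[𝓝 p ×ˢ 𝓝 p] fun q => q.2 - q.1 := by
  obtain ⟨K, t, ht, hK⟩ := hf.contDiffAt.exists_lipschitzOnWith (x := p)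
  refine IsBigO.of_bound K ?_
  filter_upwards [prod_mem_prod ht ht] with q hq
  exact hK.norm_sub_le hq.2 hq.1

lemma isBigO_taylor_of_contDiff_two {f : E → E} (hf : ContDiff ℝ 2 f) (p : E) :
    (fun q : E × E => f q.2 - f q.1 - fderiv ℝ f q.1 (q.2 - q.1)) =O[𝓝 p ×ˢ 𝓝 p]
      fun q => ‖q.2 - q.1‖ ^ 2 := by
  have h1 : ContDiff ℝ 1 (fderiv ℝ f) := hf.fderiv_right (by norm_num)
  obtain ⟨K, t, ht, hK⟩ := h1.contDiffAt.exists_lipschitzOnWith (x := p)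
  obtain ⟨ε, hε, hsub⟩ := Metric.mem_nhds_iff.1 ht
  refine IsBigO.of_bound K ?_
  filter_upwards [prod_mem_prod (Metric.ball_mem_nhds p hε) (Metric.ball_mem_nhds p hε)] with q hq
  simpa using norm_sub_sub_fderiv_le (hf.differentiable (by norm_num)) (convex_ball p ε)
    (hK.mono hsub) hq.1 hq.2

/-- `Φ γ y = y - γ A(y) + γ² B(y) + O(γ³)` as `γ → 0⁺`, locally uniformly in `y`, where `A` is of
class `C²` and `B` of class `C¹`, the regularity under which such maps can be composed. -/
structure HasExpansion (Φ : ℝ → E → E) (A B : E → E) : Prop where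
  contDiff_fst : ContDiff ℝ 2 A
  contDiff_snd : ContDiff ℝ 1 B
  isBigO (p : E) : (fun q : ℝ × E => Φ q.1 q.2 - (q.2 - q.1 • A q.2 + q.1 ^ 2 • B q.2))
    =O[𝓝[>] (0 : ℝ) ×ˢ 𝓝 p] fun q => q.1 ^ 3

namespace HasExpansion

variable {Φ Ψ : ℝ → E → E} {A B A' B' : E → E}

lemma sgdStep (hA : ContDiff ℝ 2 A) : HasExpansion (fun γ y => y - γ • A y) A 0 where
  contDiff_fst := hA
  contDiff_snd := contDiff_const
  isBigO p := by simpa using isBigO_zero _ _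

protected lemma id : HasExpansion (fun _ (y : E) => y) 0 0 where
  contDiff_fst := contDiff_const
  contDiff_snd := contDiff_const
  isBigO p := by simpa using isBigO_zero _ _

lemma average {κ : Type*} (s : Finset κ) {Φ : κ → ℝ → E → E} {A B : κ → E → E} {w : ℝ}
    (h : ∀ i ∈ s, HasExpansion (Φ i) (A i) (B i)) (hw : w * s.card = 1) :
    HasExpansion (fun γ y => w • ∑ i ∈ s, Φ i γ y) (fun y => w • ∑ i ∈ s, A i y)
      (fun y => w • ∑ i ∈ s, B i y) where
  contDiff_fst := contDiff_const.smul (ContDiff.sum fun i hi => (h i hi).contDiff_fst)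
  contDiff_snd := contDiff_const.smul (ContDiff.sum fun i hi => (h i hi).contDiff_snd)
  isBigO p := by
    have := (IsBigO.sum fun i hi => (h i hi).isBigO p).const_smul_left w
    refine this.congr_left fun q => ?_
    have hq : w • ∑ i ∈ s, q.2 = q.2 := by
      rw [Finset.sum_const, ← Nat.cast_smul_eq_nsmul ℝ, smul_smul, hw, one_smul]
    simp only [Pi.smul_apply, Finset.sum_apply, Finset.sum_sub_distrib, Finset.sum_add_distrib,
      ← Finset.smul_sum, smul_sub, smul_add, hq]
    module

lemma lookahead (h : HasExpansion Φ A B) (c : ℝ) :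
    HasExpansion (fun γ y => (1 - c) • y + c • Φ γ y) (fun y => c • A y) (fun y => c • B y) where
  contDiff_fst := contDiff_const.smul h.contDiff_fst
  contDiff_snd := contDiff_const.smul h.contDiff_snd
  isBigO p := by
    refine ((h.isBigO p).const_smul_left c).congr_left fun q => ?_
    simp only [Pi.smul_apply]
    module

/-- Truncation of the expansion after the first-order term. -/
lemma isBigO_first (h : HasExpansion Φ A B) (p : E) :
    (fun q : ℝ × E => Φ q.1 q.2 - q.2 + q.1 • A q.2)
      =O[𝓝[>] (0 : ℝ) ×ˢ 𝓝 p] fun q => q.1 ^ 2 := by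
  have h2 := (isBigO_refl (fun q : ℝ × E => q.1 ^ 2) (𝓝[>] (0 : ℝ) ×ˢ 𝓝 p)).smul
    (isBigO_of_continuous h.contDiff_snd.continuous p)
  simp only [smul_eq_mul, mul_one] at h2
  refine (((h.isBigO p).trans (isBigO_pow (by norm_num) p)).add h2).congr_left fun q => ?_
  module

lemma isBigO_zeroth (h : HasExpansion Φ A B) (p : E) :
    (fun q : ℝ × E => Φ q.1 q.2 - q.2) =O[𝓝[>] (0 : ℝ) ×ˢ 𝓝 p] fun q => q.1 := by
  have h2 := (isBigO_refl (fun q : ℝ × E => q.1) (𝓝[>] (0 : ℝ) ×ˢ 𝓝 p)).smul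
    (isBigO_of_continuous h.contDiff_fst.continuous p)
  have h1 := isBigO_pow (show 1 ≤ 2 by norm_num) p
  simp only [smul_eq_mul, mul_one, pow_one] at h2 h1
  refine (((h.isBigO_first p).trans h1).sub h2).congr_left fun q => ?_
  module

lemma tendsto_snd_apply (h : HasExpansion Φ A B) (p : E) :
    Tendsto (fun q : ℝ × E => (q.2, Φ q.1 q.2)) (𝓝[>] (0 : ℝ) ×ˢ 𝓝 p) (𝓝 p ×ˢ 𝓝 p) := by
  have h2 : Tendsto (fun q : ℝ × E => q.2) (𝓝[>] (0 : ℝ) ×ˢ 𝓝 p) (𝓝 p) := tendsto_snd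
  refine h2.prodMk ?_
  have := ((h.isBigO_zeroth p).trans_tendsto (tendsto_learningRate p)).add h2
  simpa using this

/-- Composition of expansions: the second-order terms add up, together with the interaction
`DA'(y) A(y)` of the first-order terms. -/
lemma comp (hΨ : HasExpansion Ψ A' B') (hΦ : HasExpansion Φ A B) :
    HasExpansion (fun γ y => Ψ γ (Φ γ y)) (fun y => A y + A' y)
      (fun y => B y + B' y + fderiv ℝ A' y (A y)) where
  contDiff_fst := hΦ.contDiff_fst.add hΨ.contDiff_fst
  contDiff_snd := (hΦ.contDiff_snd.add hΨ.contDiff_snd).add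
    ((hΨ.contDiff_fst.fderiv_right (by norm_num)).clm_apply (hΦ.contDiff_fst.of_le (by norm_num)))
  isBigO p := by
    set l := 𝓝[>] (0 : ℝ) ×ˢ 𝓝 p
    have hγ := isBigO_refl (fun q : ℝ × E => q.1) l
    have hlim := hΦ.tendsto_snd_apply p
    have hx : Tendsto (fun q : ℝ × E => (q.1, Φ q.1 q.2)) l l :=
      tendsto_fst.prodMk (tendsto_snd.comp hlim)
    have e1 : (fun q : ℝ × E => Ψ q.1 (Φ q.1 q.2)
        - (Φ q.1 q.2 - q.1 • A' (Φ q.1 q.2) + q.1 ^ 2 • B' (Φ q.1 q.2))) =O[l] fun q => q.1 ^ 3 :=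
      (hΨ.isBigO p).comp_tendsto hx
    have e2 : (fun q : ℝ × E => q.1 • (A' (Φ q.1 q.2) - A' q.2
        - fderiv ℝ A' q.2 (Φ q.1 q.2 - q.2))) =O[l] fun q => q.1 ^ 3 := by
      have a := (isBigO_taylor_of_contDiff_two hΨ.contDiff_fst p).comp_tendsto hlim
      have b := a.trans ((hΦ.isBigO_zeroth p).norm_left.pow 2)
      exact (hγ.smul b).congr_right fun q => by simp; ring
    have e3 : (fun q : ℝ × E => q.1 • fderiv ℝ A' q.2 (Φ q.1 q.2 - q.2 + q.1 • A q.2)) =O[l]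
        fun q => q.1 ^ 3 := by
      have a : (fun q : ℝ × E => fderiv ℝ A' q.2) =O[l] fun _ => (1 : ℝ) :=
        (((hΨ.contDiff_fst.continuous_fderiv (by norm_num)).tendsto p).comp
          tendsto_snd).isBigO_one ℝ
      have b : (fun q : ℝ × E => fderiv ℝ A' q.2 (Φ q.1 q.2 - q.2 + q.1 • A q.2)) =O[l]
          fun q => q.1 ^ 2 := by
        refine (IsBigO.of_bound 1 (Eventually.of_forall fun q => ?_)).trans
          ((a.norm_left.mul (hΦ.isBigO_first p).norm_left).congr_right fun q => one_mul _)
        simpa using (fderiv ℝ A' q.2).le_opNorm (Φ q.1 q.2 - q.2 + q.1 • A q.2)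
      exact (hγ.smul b).congr_right fun q => by simp; ring
    have e4 : (fun q : ℝ × E => q.1 ^ 2 • (B' (Φ q.1 q.2) - B' q.2)) =O[l] fun q => q.1 ^ 3 := by
      have a := ((isBigO_sub_of_contDiff_one hΨ.contDiff_snd p).comp_tendsto hlim).trans
        (hΦ.isBigO_zeroth p)
      exact ((hγ.pow 2).smul a).congr_right fun q => by simp; ring
    refine ((((e1.sub e2).sub e3).add e4).add (hΦ.isBigO p)).congr_left fun q => ?_
    simp only [map_add, map_sub, map_smul]
    module

end HasExpansion

/-- Local bounds for an expansion give uniform ones on compact sets. -/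
lemma HasExpansion.exists_bound {Φ : ℝ → E → E} {A B : E → E} (h : HasExpansion Φ A B)
    {K : Set E} (hK : IsCompact K) : ∃ C : ℝ, ∀ᶠ γ in 𝓝[>] (0 : ℝ), ∀ y ∈ K,
      ‖Φ γ y - (y - γ • A y + γ ^ 2 • B y)‖ ≤ C * γ ^ 3 := by
  refine hK.induction_on (p := fun K => ∃ C : ℝ, ∀ᶠ γ in 𝓝[>] (0 : ℝ), ∀ y ∈ K,
      ‖Φ γ y - (y - γ • A y + γ ^ 2 • B y)‖ ≤ C * γ ^ 3) ⟨0, by simp⟩ ?_ ?_ ?_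
  · rintro s t hst ⟨C, hC⟩
    exact ⟨C, hC.mono fun γ hγ y hy => hγ y (hst hy)⟩
  · rintro s t ⟨C, hC⟩ ⟨C', hC'⟩
    refine ⟨max C C', ?_⟩
    filter_upwards [hC, hC', self_mem_nhdsWithin] with γ h1 h2 h0 y hy
    have h0' : (0 : ℝ) ≤ γ ^ 3 := pow_nonneg (le_of_lt h0) 3
    rcases hy with hy | hy
    · exact (h1 y hy).trans (mul_le_mul_of_nonneg_right (le_max_left _ _) h0')
    · exact (h2 y hy).trans (mul_le_mul_of_nonneg_right (le_max_right _ _) h0')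
  · intro p _
    obtain ⟨C, hC⟩ := (h.isBigO p).bound
    obtain ⟨s, hs, t, ht, hst⟩ := mem_prod_iff.1 hC
    refine ⟨t, mem_nhdsWithin_of_mem_nhds ht, C, ?_⟩
    filter_upwards [hs, self_mem_nhdsWithin] with γ hγ h0 y hy
    have := hst (mk_mem_prod hγ hy)
    have h0' : (0 : ℝ) ≤ γ ^ 3 := pow_nonneg (le_of_lt h0) 3
    simpa [abs_of_nonneg h0', abs_of_pos (show 0 < γ from h0)] using this

end Expansion

/-! ### Expansion of the Lookahead iterates -/

section PairSums

variable {V : Type*} [AddCommGroup V] [Module ℝ V]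

/-- The second-order coefficient of `r` consecutive rounds of length `len` that start at iteration
`t`, when a round starting at `s` has second-order coefficient `B s` and first-order coefficient
`a ∑ g u` over its iterations `u`. Here `P s s'` stands for the interaction `Dg_s g_{s'}` of an
iteration `s` with an earlier iteration `s'`. -/
noncomputable def runPairSum (len : ℕ) (a : ℝ) (P : ℕ → ℕ → V) (B : ℕ → V) (t : ℕ) : ℕ → V
  | 0 => 0
  | r + 1 => runPairSum len a P B t r + B (t + r * len) +
      a ^ 2 • ∑ s ∈ Finset.Ico (t + r * len) (t + r * len + len),
        ∑ s' ∈ Finset.Ico t (t + r * len), P s s'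

/-- The second-order coefficient of a round of `n`-layer Lookahead starting at iteration `t`, as a
linear combination of the interactions `P s s'`. -/
noncomputable def roundPairSum (k : ℕ → ℕ) (α : ℕ → ℝ) (P : ℕ → ℕ → V) : ℕ → ℕ → V
  | 0, _ => 0
  | n + 1, t => α n • runPairSum (∏ q ∈ Finset.range n, k q) (∏ q ∈ Finset.range n, α q) P
      (roundPairSum k α P n) t (k n)

variable {κ : Type*} [Fintype κ] {P : κ → ℕ → ℕ → V} {W : V} {m : ℕ}

/-- Second-order coefficients of `r` rounds, summed over `κ`: besides the contributions within the
rounds, there are `len²` pairs of iterations for each of the `r (r - 1) / 2` pairs of rounds. -/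
lemma sum_runPairSum (hP : ∀ s s', s ≠ s' → s < m → s' < m → ∑ σ, P σ s s' = W)
    {B : κ → ℕ → V} {len : ℕ} {c : ℝ} (hB : ∀ s, s + len ≤ m → ∑ σ, B σ s = c • W) (a : ℝ)
    (t r : ℕ) (h : t + r * len ≤ m) :
    ∑ σ, runPairSum len a (P σ) (B σ) t r = (r * c + a ^ 2 * len ^ 2 * (r * (r - 1) / 2)) • W := by
  induction r with
  | zero => simp [runPairSum]
  | succ r ih =>
    have h' : t + r * len + len ≤ m := by linarith [Nat.succ_mul r len]
    have hpairs : ∑ σ, ∑ s ∈ Finset.Ico (t + r * len) (t + r * len + len),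
        ∑ s' ∈ Finset.Ico t (t + r * len), P σ s s' = ((len : ℝ) * (r * len)) • W := by
      rw [Finset.sum_comm]
      have : ∀ s ∈ Finset.Ico (t + r * len) (t + r * len + len),
          ∑ σ, ∑ s' ∈ Finset.Ico t (t + r * len), P σ s s' = ((r : ℝ) * len) • W := by
        intro s hs
        rw [Finset.sum_comm, Finset.sum_congr rfl (g := fun _ => W)]
        · rw [Finset.sum_const, ← Nat.cast_smul_eq_nsmul ℝ]
          simp
        · intro s' hs'
          simp only [Finset.mem_Ico] at hs hs'
          exact hP s s' (by omega) (by omega) (by omega)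
      rw [Finset.sum_congr rfl this, Finset.sum_const, ← Nat.cast_smul_eq_nsmul ℝ, smul_smul]
      simp
    simp only [runPairSum, Finset.sum_add_distrib, ← Finset.smul_sum]
    rw [ih (by omega), hB _ h', hpairs]
    push_cast
    module

/-- If the interactions of any two distinct iterations have the same sum `W`, the second-order
coefficients of a round sum to a multiple of `W`: the total weight of the pairs of iterations. -/
lemma sum_roundPairSum (hP : ∀ s s', s ≠ s' → s < m → s' < m → ∑ σ, P σ s s' = W)
    (k : ℕ → ℕ) (α : ℕ → ℝ) (n t : ℕ) (h : t + ∏ q ∈ Finset.range n, k q ≤ m) :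
    ∑ σ, roundPairSum k α (P σ) n t =
      ((∏ q ∈ Finset.range n, α q) * (∏ q ∈ Finset.range n, (k q : ℝ)) *
        ((∑ p ∈ Finset.range n, (1 - α p) * (∏ q ∈ Finset.range p, α q) *
          ((∏ q ∈ Finset.range (p + 1), (k q : ℝ)) - 1)) +
        (∏ q ∈ Finset.range n, α q) * ((∏ q ∈ Finset.range n, (k q : ℝ)) - 1)) / 2) • W := by
  induction n generalizing t with
  | zero => simp [roundPairSum]
  | succ n ih =>
    rw [Finset.prod_range_succ, mul_comm] at h
    simp only [roundPairSum, ← Finset.smul_sum]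
    rw [sum_runPairSum hP (fun s hs => ih s hs) _ t (k n) h, smul_smul]
    congr 1
    simp only [Finset.prod_range_succ, Finset.sum_range_succ, Nat.cast_prod]
    ring

end PairSums

section RoundExpansion

variable {E : Type*} [NormedAddCommGroup E] [NormedSpace ℝ E]

/-- The interaction `Dg_s(y) g_{s'}(y)` of two steps along the fields `g s` and `g s'`. -/
noncomputable def interaction (g : ℕ → E → E) (y : E) (s s' : ℕ) : E :=
  fderiv ℝ (g s) y (g s' y)

variable {g : ℕ → E → E}

lemma HasExpansion.runRounds (hg : ∀ t, ContDiff ℝ 2 (g t)) {step : ℝ → ℕ → E → E}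
    {len : ℕ} {a : ℝ} {B : ℕ → E → E}
    (h : ∀ s, HasExpansion (fun γ => step γ s)
      (fun y => a • ∑ u ∈ Finset.Ico s (s + len), g u y) (B s)) (t r : ℕ) :
    HasExpansion (fun γ => Lookahead.runRounds (step γ) len t r)
      (fun y => a • ∑ u ∈ Finset.Ico t (t + r * len), g u y)
      (fun y => runPairSum len a (interaction g y) (fun s => B s y) t r) := by
  induction r with
  | zero => simpa [runPairSum, Lookahead.runRounds] using! HasExpansion.id
  | succ r ih =>
    convert (h (t + r * len)).comp ih using 1
    · rfl
    · ext y
      rw [← smul_add, Finset.sum_Ico_consecutive _ (by omega) (by omega), Nat.succ_mul, add_assoc]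
    · ext y
      have hd : fderiv ℝ (fun y => a • ∑ u ∈ Finset.Ico (t + r * len) (t + r * len + len), g u y) y
          = a • ∑ u ∈ Finset.Ico (t + r * len) (t + r * len + len), fderiv ℝ (g u) y := by
        have hd' : ∀ u, DifferentiableAt ℝ (g u) y :=
          fun u => (hg u).differentiable (by norm_num) y
        rw [fderiv_fun_const_smul (DifferentiableAt.fun_sum fun u _ => hd' u),
          fderiv_fun_sum fun u _ => hd' u]
      simp only [runPairSum, hd, interaction, map_smul, map_sum, smul_apply,
        sum_apply, ← Finset.smul_sum, smul_smul, pow_two]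
      rw [Finset.sum_comm]

lemma HasExpansion.round (hg : ∀ t, ContDiff ℝ 2 (g t)) (k : ℕ → ℕ) (α : ℕ → ℝ) (n t : ℕ) :
    HasExpansion (fun γ => Lookahead.round g γ k α n t)
      (fun y => (∏ q ∈ Finset.range n, α q) •
        ∑ u ∈ Finset.Ico t (t + ∏ q ∈ Finset.range n, k q), g u y)
      (fun y => roundPairSum k α (interaction g y) n t) := by
  induction n generalizing t with
  | zero => simpa [roundPairSum, Lookahead.round] using! HasExpansion.sgdStep (hg t)
  | succ n ih =>
    convert (HasExpansion.runRounds hg ih t (k n)).lookahead (α n) using 1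
    · rfl
    · ext y
      rw [Finset.prod_range_succ, Finset.prod_range_succ, mul_comm _ (k n), smul_smul, mul_comm]
    · rfl

lemma HasExpansion.output (hg : ∀ t, ContDiff ℝ 2 (g t)) (k : ℕ → ℕ) (α : ℕ → ℝ) (n r : ℕ) :
    HasExpansion (fun γ => Lookahead.output g γ k α n r)
      (fun y => (∏ q ∈ Finset.range n, α q) •
        ∑ u ∈ Finset.range (r * ∏ q ∈ Finset.range n, k q), g u y)
      (fun y => runPairSum (∏ q ∈ Finset.range n, k q) (∏ q ∈ Finset.range n, α q)
        (interaction g y) (roundPairSum k α (interaction g y) n) 0 r) := by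
  have h := HasExpansion.runRounds hg (HasExpansion.round hg k α n) 0 r
  simp only [zero_add, ← Finset.range_eq_Ico] at h
  exact h

end RoundExpansion

section Frozen

variable {E : Type*} [AddCommGroup E] [Module ℝ E]

/-- A layer with `α p = 0` resets every iterate to the outer point. -/
lemma round_eq_self (g : ℕ → E → E) (γ : ℝ) (k : ℕ → ℕ) {α : ℕ → ℝ} {n : ℕ}
    (h : ∏ q ∈ Finset.range n, α q = 0) (t : ℕ) (y : E) : round g γ k α n t y = y := by
  induction n generalizing t y with
  | zero => simp at h
  | succ n ih =>
    rw [Finset.prod_range_succ, mul_eq_zero] at h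
    rcases h with h | h
    · have : ∀ r, runRounds (round g γ k α n) (∏ q ∈ Finset.range n, k q) t r y = y := by
        intro r
        induction r with
        | zero => rfl
        | succ r ihr => rw [runRounds, ihr, ih h]
      rw [round, this]
      module
    · simp [round, h]

lemma output_eq_self (g : ℕ → E → E) (γ : ℝ) (k : ℕ → ℕ) {α : ℕ → ℝ} {n : ℕ}
    (h : ∏ q ∈ Finset.range n, α q = 0) (r : ℕ) (y : E) : output g γ k α n r y = y := by
  unfold output
  induction r with
  | zero => rfl
  | succ r ih => rw [runRounds, ih, round_eq_self g γ k h]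

end Frozen

/-! ### Gradients of the losses and of their quadratic statistics -/

section Gradient

variable {E : Type*} [NormedAddCommGroup E] [InnerProductSpace ℝ E] [CompleteSpace E]

lemma contDiff_gradient {h : E → ℝ} {i j : WithTop ℕ∞} (hh : ContDiff ℝ j h) (hij : i + 1 ≤ j) :
    ContDiff ℝ i (gradient h) :=
  (InnerProductSpace.toDual ℝ E).symm.toContinuousLinearEquiv.contDiff.comp (hh.fderiv_right hij)

/-- The Hessian, as the derivative of the gradient, is symmetric. -/
lemma inner_fderiv_gradient_comm {h : E → ℝ} (hh : ContDiff ℝ 2 h) (y v w : E) :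
    inner ℝ (fderiv ℝ (gradient h) y v) w = inner ℝ v (fderiv ℝ (gradient h) y w) := by
  have key : ∀ v w, inner ℝ (fderiv ℝ (gradient h) y v) w = fderiv ℝ (fderiv ℝ h) y v w := by
    intro v w
    have hd : DifferentiableAt ℝ (fderiv ℝ h) y :=
      (hh.fderiv_right (m := 1) (by norm_num)).differentiable (by norm_num) y
    have hg : DifferentiableAt ℝ (gradient h) y :=
      (contDiff_gradient (i := 1) hh (by norm_num)).differentiable (by norm_num) y
    have h1 := hg.hasFDerivAt.inner ℝ (hasFDerivAt_const w y)
    have h2 := hd.hasFDerivAt.clm_apply (hasFDerivAt_const w y)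
    simp only [inner_gradient_left] at h1
    simpa using congrArg (fun L => L v) (h1.unique h2)
  rw [key, real_inner_comm, key]
  exact (hh.contDiffAt.isSymmSndFDerivAt (by simp)).eq v w

lemma hasGradientAt_inner_gradient {h₁ h₂ : E → ℝ} (hh₁ : ContDiff ℝ 2 h₁) (hh₂ : ContDiff ℝ 2 h₂)
    (y : E) : HasGradientAt (fun y => inner ℝ (gradient h₁ y) (gradient h₂ y))
      (fderiv ℝ (gradient h₁) y (gradient h₂ y) + fderiv ℝ (gradient h₂) y (gradient h₁ y)) y := by
  have d : ∀ {h : E → ℝ}, ContDiff ℝ 2 h → HasFDerivAt (gradient h) (fderiv ℝ (gradient h) y) y :=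
    fun hh => ((contDiff_gradient (i := 1) hh (by norm_num)).differentiable
      (by norm_num) y).hasFDerivAt
  rw [hasGradientAt_iff_hasFDerivAt]
  refine ((d hh₁).inner ℝ (d hh₂)).congr_fderiv ?_
  ext v
  have e₁ := inner_fderiv_gradient_comm hh₁ y v (gradient h₂ y)
  have e₂ := inner_fderiv_gradient_comm hh₂ y (gradient h₁ y) v
  simp only [InnerProductSpace.toDual_apply_apply, inner_add_left, ContinuousLinearMap.comp_apply,
    ContinuousLinearMap.prod_apply, fderivInnerCLM_apply, e₁, e₂]
  linarith [real_inner_comm v (fderiv ℝ (gradient h₁) y (gradient h₂ y))]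

lemma hasGradientAt_const_mul {h : E → ℝ} {h' y : E} (c : ℝ) (hh : HasGradientAt h h' y) :
    HasGradientAt (fun y => c * h y) (c • h') y := by
  rw [hasGradientAt_iff_hasFDerivAt] at hh ⊢
  simpa using hh.const_mul c

lemma hasGradientAt_add {h₁ h₂ : E → ℝ} {h₁' h₂' y : E} (hh₁ : HasGradientAt h₁ h₁' y)
    (hh₂ : HasGradientAt h₂ h₂' y) : HasGradientAt (fun y => h₁ y + h₂ y) (h₁' + h₂') y := by
  rw [hasGradientAt_iff_hasFDerivAt] at hh₁ hh₂ ⊢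
  simpa using hh₁.fun_add hh₂

lemma hasGradientAt_sum {κ : Type*} (s : Finset κ) {h : κ → E → ℝ} {h' : κ → E} {y : E}
    (hh : ∀ i ∈ s, HasGradientAt (h i) (h' i) y) :
    HasGradientAt (fun y => ∑ i ∈ s, h i y) (∑ i ∈ s, h' i) y := by
  simp only [hasGradientAt_iff_hasFDerivAt] at hh ⊢
  simpa using HasFDerivAt.fun_sum hh

end Gradient

section Loss

variable {ι : Type*} [Fintype ι] {E : Type*} {loss : ι → E → ℝ} {m b : ℕ}

/-- The full loss is the average of the losses of the mini-batches of any reshuffling. -/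
lemma fullLoss_eq_batchLoss (σ : ι ≃ Fin m × Fin b) (y : E) :
    fullLoss loss y = (m : ℝ)⁻¹ * ∑ t ∈ Finset.range m, batchLoss loss σ t y := by
  have hcard : Fintype.card ι = m * b := by simpa using Fintype.card_congr σ
  have h : ∑ t ∈ Finset.range m, ∑ s with ((σ s).1 : ℕ) = t, loss s y = ∑ s, loss s y :=
    Finset.sum_fiberwise_of_maps_to (fun s _ => Finset.mem_range.2 (σ s).1.2) _
  simp only [fullLoss, batchLoss, ← Finset.mul_sum, h, hcard]
  push_cast
  rw [mul_inv, mul_assoc]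

lemma batchLoss_of_le (σ : ι ≃ Fin m × Fin b) {t : ℕ} (ht : m ≤ t) :
    batchLoss loss σ t = fun _ => 0 := by
  ext y
  have : (Finset.univ.filter fun s => ((σ s).1 : ℕ) = t) = ∅ :=
    Finset.filter_false_of_mem fun s _ => by have := (σ s).1.2; omega
  simp [batchLoss, this]

variable [NormedAddCommGroup E] [InnerProductSpace ℝ E]

lemma contDiff_batchLoss (hloss : ∀ s, ContDiff ℝ 3 (loss s)) (σ : ι ≃ Fin m × Fin b) (t : ℕ) :
    ContDiff ℝ 3 (batchLoss loss σ t) :=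
  contDiff_const.mul (ContDiff.sum fun s _ => hloss s)

lemma contDiff_fullLoss (hloss : ∀ s, ContDiff ℝ 3 (loss s)) : ContDiff ℝ 3 (fullLoss loss) :=
  contDiff_const.mul (ContDiff.sum fun s _ => hloss s)

variable [CompleteSpace E]

/-- The gradient field `∇f_t` that drives iteration `t` of the epoch. -/
noncomputable def batchGrad (loss : ι → E → ℝ) (σ : ι ≃ Fin m × Fin b) (t : ℕ) : E → E :=
  gradient (batchLoss loss σ t)

lemma contDiff_batchGrad (hloss : ∀ s, ContDiff ℝ 3 (loss s)) (σ : ι ≃ Fin m × Fin b) (t : ℕ) :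
    ContDiff ℝ 2 (batchGrad loss σ t) :=
  contDiff_gradient (contDiff_batchLoss hloss σ t) (by norm_num)

lemma contDiff_interaction (hloss : ∀ s, ContDiff ℝ 3 (loss s)) (σ : ι ≃ Fin m × Fin b)
    (s s' : ℕ) : ContDiff ℝ 1 fun y => interaction (batchGrad loss σ) y s s' :=
  ((contDiff_batchGrad hloss σ s).fderiv_right (by norm_num)).clm_apply
    ((contDiff_batchGrad hloss σ s').of_le (by norm_num))

lemma gradient_fullLoss (hloss : ∀ s, ContDiff ℝ 3 (loss s)) (σ : ι ≃ Fin m × Fin b) :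
    gradient (fullLoss loss) = fun y => (m : ℝ)⁻¹ • ∑ t ∈ Finset.range m, batchGrad loss σ t y := by
  refine gradient_eq fun y => ?_
  rw [funext fun y => fullLoss_eq_batchLoss (loss := loss) σ y]
  exact hasGradientAt_const_mul _ (hasGradientAt_sum _ fun t _ =>
    ((contDiff_batchLoss hloss σ t).differentiable (by norm_num) y).hasGradientAt)

lemma batchGrad_of_le (σ : ι ≃ Fin m × Fin b) {t : ℕ} (ht : m ≤ t) :
    batchGrad loss σ t = fun _ => 0 := by
  rw [batchGrad, batchLoss_of_le σ ht]
  exact gradient_fun_const' 0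

variable [DecidableEq ι]

/-- The mean interaction `𝔼[D∇f_s(y) ∇f_{s'}(y)]` of iterations `s` and `s'`. -/
noncomputable def meanInteraction (loss : ι → E → ℝ) (m b s s' : ℕ) (y : E) : E :=
  shuffleMean fun σ : ι ≃ Fin m × Fin b => interaction (batchGrad loss σ) y s s'

lemma contDiff_meanInteraction (hloss : ∀ s, ContDiff ℝ 3 (loss s)) (s s' : ℕ) :
    ContDiff ℝ 1 (meanInteraction loss m b s s') :=
  contDiff_const.smul (ContDiff.sum fun σ _ => contDiff_interaction hloss σ s s')

lemma contDiff_AN (hloss : ∀ s, ContDiff ℝ 3 (loss s)) : ContDiff ℝ 2 (AN loss m b) :=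
  contDiff_const.mul (ContDiff.sum fun σ _ => (contDiff_batchGrad hloss σ 0).norm_sq ℝ)

lemma contDiff_AI (hloss : ∀ s, ContDiff ℝ 3 (loss s)) : ContDiff ℝ 2 (AI loss m b) :=
  contDiff_const.mul (ContDiff.sum fun σ _ =>
    (contDiff_batchGrad hloss σ 0).inner ℝ (contDiff_batchGrad hloss σ 1))

/-- Renumbering the mini-batches is a bijection of the set of reshufflings. -/
lemma sum_interaction_perm (e : Equiv.Perm (Fin m)) (s s' : Fin m) (y : E) :
    ∑ σ : ι ≃ Fin m × Fin b, interaction (batchGrad loss σ) y (e s) (e s') =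
      ∑ σ : ι ≃ Fin m × Fin b, interaction (batchGrad loss σ) y s s' := by
  have h : ∀ (σ : ι ≃ Fin m × Fin b) (i : Fin m),
      batchGrad loss (σ.trans (e.prodCongr (Equiv.refl (Fin b)))) (e i) = batchGrad loss σ i := by
    intro σ i
    unfold batchGrad batchLoss
    simp [← Fin.ext_iff]
  refine (Fintype.sum_equiv
    (Equiv.equivCongr (Equiv.refl ι) (e.prodCongr (Equiv.refl (Fin b)))) _ _ fun σ => ?_).symm
  change interaction (batchGrad loss σ) y s s' = interaction
    (batchGrad loss (σ.trans (e.prodCongr (Equiv.refl (Fin b))))) y (e s) (e s')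
  rw [interaction, interaction, h, h]

lemma sum_interaction_diag {s u : ℕ} (hs : s < m) (hu : u < m) (y : E) :
    ∑ σ : ι ≃ Fin m × Fin b, interaction (batchGrad loss σ) y s s =
      ∑ σ : ι ≃ Fin m × Fin b, interaction (batchGrad loss σ) y u u := by
  have := sum_interaction_perm (loss := loss) (b := b) (Equiv.swap ⟨u, hu⟩ ⟨s, hs⟩) ⟨u, hu⟩ ⟨u, hu⟩ y
  simpa using this

/-- By exchangeability of the mini-batches, any two distinct iterations interact alike. -/
lemma sum_interaction_offDiag {s s' u u' : ℕ} (hs : s < m) (hs' : s' < m) (h : s ≠ s')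
    (hu : u < m) (hu' : u' < m) (h' : u ≠ u') (y : E) :
    ∑ σ : ι ≃ Fin m × Fin b, interaction (batchGrad loss σ) y s s' =
      ∑ σ : ι ≃ Fin m × Fin b, interaction (batchGrad loss σ) y u u' := by
  obtain ⟨e, he, he'⟩ : ∃ e : Equiv.Perm (Fin m), e ⟨u, hu⟩ = ⟨s, hs⟩ ∧ e ⟨u', hu'⟩ = ⟨s', hs'⟩ := by
    set e₁ : Equiv.Perm (Fin m) := Equiv.swap ⟨u, hu⟩ ⟨s, hs⟩
    have h1 : e₁ ⟨u, hu⟩ = ⟨s, hs⟩ := Equiv.swap_apply_left _ _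
    refine ⟨e₁.trans (Equiv.swap (e₁ ⟨u', hu'⟩) ⟨s', hs'⟩), ?_, by simp⟩
    rw [Equiv.trans_apply, h1, Equiv.swap_apply_of_ne_of_ne]
    · rw [← h1]
      exact fun hh => h' (by simpa using e₁.injective hh)
    · simpa using h
  have := sum_interaction_perm (loss := loss) (b := b) e ⟨u, hu⟩ ⟨u', hu'⟩ y
  rwa [he, he'] at this

lemma meanInteraction_one_zero (y : E) :
    meanInteraction loss m b 1 0 y = meanInteraction loss m b 0 1 y := by
  unfold meanInteraction shuffleMean
  congr 1
  rcases Nat.lt_or_ge 1 m with hm | hm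
  · exact sum_interaction_offDiag hm (by omega) (by omega) (by omega) hm (by omega) y
  · simp [interaction, batchGrad_of_le _ hm]

lemma hasGradientAt_AN (hloss : ∀ s, ContDiff ℝ 3 (loss s)) (y : E) :
    HasGradientAt (AN loss m b) ((2 : ℝ) • meanInteraction loss m b 0 0 y) y := by
  have h := hasGradientAt_const_mul (Fintype.card (ι ≃ Fin m × Fin b) : ℝ)⁻¹
    (hasGradientAt_sum Finset.univ fun σ : ι ≃ Fin m × Fin b => fun _ =>
      hasGradientAt_inner_gradient ((contDiff_batchLoss hloss σ 0).of_le (by norm_num))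
        ((contDiff_batchLoss hloss σ 0).of_le (by norm_num)) y)
  simp only [real_inner_self_eq_norm_sq, Finset.sum_add_distrib] at h
  rwa [← two_smul ℝ, smul_comm] at h

lemma hasGradientAt_AI (hloss : ∀ s, ContDiff ℝ 3 (loss s)) (y : E) :
    HasGradientAt (AI loss m b) ((2 : ℝ) • meanInteraction loss m b 0 1 y) y := by
  have h := hasGradientAt_const_mul (Fintype.card (ι ≃ Fin m × Fin b) : ℝ)⁻¹
    (hasGradientAt_sum Finset.univ fun σ : ι ≃ Fin m × Fin b => fun _ =>
      hasGradientAt_inner_gradient ((contDiff_batchLoss hloss σ 0).of_le (by norm_num))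
        ((contDiff_batchLoss hloss σ 1).of_le (by norm_num)) y)
  rw [Finset.sum_add_distrib, smul_add] at h
  have e : (2 : ℝ) • meanInteraction loss m b 0 1 y
      = meanInteraction loss m b 0 1 y + meanInteraction loss m b 1 0 y := by
    rw [meanInteraction_one_zero, two_smul]
  rw [e]
  exact h

lemma card_smul_shuffleMean {V : Type*} [AddCommGroup V] [Module ℝ V]
    (hcard : Fintype.card ι = m * b) (X : (ι ≃ Fin m × Fin b) → V) :
    (Fintype.card (ι ≃ Fin m × Fin b) : ℝ) ≠ 0 ∧
      ∑ σ, X σ = (Fintype.card (ι ≃ Fin m × Fin b) : ℝ) • shuffleMean X := by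
  have e : ι ≃ Fin m × Fin b := Fintype.equivOfCardEq (by simpa using hcard)
  have h : (Fintype.card (ι ≃ Fin m × Fin b) : ℝ) ≠ 0 :=
    by
    have : Nonempty (ι ≃ Fin m × Fin b) := ⟨e⟩
    exact Nat.cast_ne_zero.2 Fintype.card_ne_zero
  exact ⟨h, by rw [shuffleMean, smul_inv_smul₀ h]⟩

/-- The mean of `D∇f ∇f` consists of the `m` diagonal and `m (m - 1)` off-diagonal interactions of
the mini-batches. -/
lemma fderiv_gradient_fullLoss (hloss : ∀ s, ContDiff ℝ 3 (loss s)) (hm : 0 < m)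
    (hcard : Fintype.card ι = m * b) (y : E) :
    fderiv ℝ (gradient (fullLoss loss)) y (gradient (fullLoss loss) y) =
      (m : ℝ)⁻¹ • (meanInteraction loss m b 0 0 y +
        ((m : ℝ) - 1) • meanInteraction loss m b 0 1 y) := by
  have hσ : ∀ σ : ι ≃ Fin m × Fin b,
      fderiv ℝ (gradient (fullLoss loss)) y (gradient (fullLoss loss) y) =
      ((m : ℝ)⁻¹ ^ 2) • ∑ s ∈ Finset.range m, ∑ s' ∈ Finset.range m,
        interaction (batchGrad loss σ) y s s' := by
    intro σ
    have hd : ∀ u, DifferentiableAt ℝ (batchGrad loss σ u) y :=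
      fun u => (contDiff_batchGrad hloss σ u).differentiable (by norm_num) y
    rw [gradient_fullLoss hloss σ,
      fderiv_fun_const_smul (DifferentiableAt.fun_sum fun u _ => hd u),
      fderiv_fun_sum fun u _ => hd u]
    simp only [interaction, map_smul, map_sum, smul_apply, sum_apply, ← Finset.smul_sum, smul_smul,
      pow_two]
    rw [Finset.sum_comm]
  obtain ⟨hc, -⟩ := card_smul_shuffleMean (V := E) hcard 0
  set c : ℝ := (Fintype.card (ι ≃ Fin m × Fin b) : ℝ)
  have hN := (card_smul_shuffleMean hcard
    fun σ : ι ≃ Fin m × Fin b => interaction (batchGrad loss σ) y 0 0).2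
  have hW := (card_smul_shuffleMean hcard
    fun σ : ι ≃ Fin m × Fin b => interaction (batchGrad loss σ) y 0 1).2
  have hpair : ∀ s ∈ Finset.range m, ∀ s' ∈ Finset.range m,
      ∑ σ : ι ≃ Fin m × Fin b, interaction (batchGrad loss σ) y s s' =
        c • meanInteraction loss m b 0 1 y + if s = s' then c • meanInteraction loss m b 0 0 y
          - c • meanInteraction loss m b 0 1 y else 0 := by
    intro s hs s' hs'
    rw [Finset.mem_range] at hs hs'
    split_ifs with h
    · subst h
      rw [sum_interaction_diag hs hm, hN, add_sub_cancel]
      rfl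
    · rw [sum_interaction_offDiag hs hs' h (u := 0) (u' := 1) hm (by omega) (by omega), hW,
        add_zero]
      rfl
  have htot : c • fderiv ℝ (gradient (fullLoss loss)) y (gradient (fullLoss loss) y) =
      c • ((m : ℝ)⁻¹ • (meanInteraction loss m b 0 0 y +
        ((m : ℝ) - 1) • meanInteraction loss m b 0 1 y)) := by
    calc _ = ∑ σ : ι ≃ Fin m × Fin b,
          fderiv ℝ (gradient (fullLoss loss)) y (gradient (fullLoss loss) y) := by
          rw [Finset.sum_const, ← Nat.cast_smul_eq_nsmul ℝ, Finset.card_univ]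
      _ = ((m : ℝ)⁻¹ ^ 2) • ∑ s ∈ Finset.range m, ∑ s' ∈ Finset.range m,
          ∑ σ : ι ≃ Fin m × Fin b, interaction (batchGrad loss σ) y s s' := by
          rw [Finset.sum_congr rfl fun σ _ => hσ σ, ← Finset.smul_sum, Finset.sum_comm]
          congr 1
          exact Finset.sum_congr rfl fun s _ => Finset.sum_comm
      _ = _ := by
          rw [Finset.sum_congr rfl fun s hs => Finset.sum_congr rfl (hpair s hs)]
          have : (m : ℝ) ≠ 0 := by positivity
          simp only [Finset.sum_add_distrib, Finset.sum_ite_eq, Finset.sum_const,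
            Finset.card_range, Finset.sum_ite_mem, Finset.inter_self,
            ← Nat.cast_smul_eq_nsmul ℝ]
          match_scalars
          · field_simp
            ring
          · field_simp
  exact smul_right_injective E hc htot

/-- The coefficient of `-(γ / 4) AI` in the modified loss. -/
noncomputable def interBatchWeight (k : ℕ → ℕ) (α : ℕ → ℝ) (n : ℕ) : ℝ :=
  ∑ p ∈ Finset.range n, (1 - α p) * (∏ q ∈ Finset.range p, α q) *
    ((∏ q ∈ Finset.range (p + 1), (k q : ℝ)) - 1)

lemma gradient_modifiedLoss (hloss : ∀ s, ContDiff ℝ 3 (loss s)) (k : ℕ → ℕ) (α : ℕ → ℝ) (n : ℕ)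
    (γ : ℝ) (y : E) :
    gradient (modifiedLoss loss m b k α n γ) y = gradient (fullLoss loss) y +
      γ • (((∏ q ∈ Finset.range n, α q) / 2) • meanInteraction loss m b 0 0 y
        - (interBatchWeight k α n / 2) • meanInteraction loss m b 0 1 y) := by
  have h := hasGradientAt_add (hasGradientAt_add
    ((contDiff_fullLoss hloss).differentiable (by norm_num) y).hasGradientAt
    (hasGradientAt_const_mul (γ * (∏ q ∈ Finset.range n, α q) / 4)
      (hasGradientAt_AN (m := m) (b := b) hloss y)))
    (hasGradientAt_const_mul (-(γ / 4 * interBatchWeight k α n))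
      (hasGradientAt_AI (m := m) (b := b) hloss y))
  have e : modifiedLoss loss m b k α n γ = fun y => fullLoss loss y +
      γ * (∏ q ∈ Finset.range n, α q) / 4 * AN loss m b y +
      -(γ / 4 * interBatchWeight k α n) * AI loss m b y := by
    ext y
    rw [modifiedLoss, interBatchWeight]
    ring
  rw [e, h.gradient]
  module

lemma contDiff_modifiedLoss (hloss : ∀ s, ContDiff ℝ 3 (loss s)) (k : ℕ → ℕ) (α : ℕ → ℝ) (n : ℕ)
    (γ : ℝ) : ContDiff ℝ 2 (modifiedLoss loss m b k α n γ) :=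
  (((contDiff_fullLoss hloss).of_le (by norm_num)).add
    (contDiff_const.mul (contDiff_AN hloss))).sub (contDiff_const.mul (contDiff_AI hloss))

/-! ### Expansion of the mean epoch output -/

/-- The first-order coefficient does not depend on the reshuffling; the second-order one is reduced
to a single mean interaction by exchangeability. -/
lemma hasExpansion_meanEpochOutput (hloss : ∀ s, ContDiff ℝ 3 (loss s))
    (hm : 0 < m) (hcard : Fintype.card ι = m * b) (k : ℕ → ℕ) (α : ℕ → ℝ) (n : ℕ)
    (hdvd : (∏ q ∈ Finset.range n, k q) ∣ m) :
    HasExpansion (fun γ => meanEpochOutput loss m b γ k α n)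
      (fun y => ((∏ q ∈ Finset.range n, α q) * m) • gradient (fullLoss loss) y)
      (fun y => ((∏ q ∈ Finset.range n, α q) * m * (interBatchWeight k α n +
        (∏ q ∈ Finset.range n, α q) * (m - 1)) / 2) • meanInteraction loss m b 0 1 y) := by
  obtain ⟨hc, -⟩ := card_smul_shuffleMean (V := E) hcard 0
  have h := HasExpansion.average (Finset.univ : Finset (ι ≃ Fin m × Fin b))
    (w := (Fintype.card (ι ≃ Fin m × Fin b) : ℝ)⁻¹)
    (fun σ _ => HasExpansion.output (contDiff_batchGrad hloss σ) k α n
      (m / ∏ q ∈ Finset.range n, k q)) (by rw [Finset.card_univ, inv_mul_cancel₀ hc])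
  rw [Nat.div_mul_cancel hdvd] at h
  have hm' : (m : ℝ) ≠ 0 := by positivity
  convert h using 1
  · rfl
  · ext y
    have : ∀ σ : ι ≃ Fin m × Fin b, ∑ u ∈ Finset.range m, batchGrad loss σ u y =
        (m : ℝ) • gradient (fullLoss loss) y := by
      intro σ
      rw [gradient_fullLoss hloss σ, smul_inv_smul₀ hm']
    simp only [this, Finset.sum_const, Finset.card_univ, ← Nat.cast_smul_eq_nsmul ℝ]
    rw [inv_smul_smul₀ hc, smul_smul]
  · ext y
    have hP := fun s s' (hss : s ≠ s') (hs : s < m) (hs' : s' < m) =>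
      (sum_interaction_offDiag (b := b) (loss := loss) hs hs' hss (u := 0) (u' := 1) hm (by omega)
        (by omega) y).trans (card_smul_shuffleMean hcard _).2
    rw [sum_runPairSum hP (fun s hs => sum_roundPairSum hP k α n s hs) _ 0 _
      (by rw [Nat.div_mul_cancel hdvd]; omega), smul_comm, inv_smul_smul₀ hc]
    have hK : ((m / ∏ q ∈ Finset.range n, k q : ℕ) : ℝ) * ∏ q ∈ Finset.range n, (k q : ℝ) = m := by
      rw [← Nat.cast_prod, ← Nat.cast_mul, Nat.div_mul_cancel hdvd]
    unfold meanInteraction interBatchWeight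
    congr 1
    rw [← hK]
    push_cast
    ring

end Loss

/-! ### Flows over a time of the order of the learning rate -/

section Flow

open Metric

variable {E : Type*} [NormedAddCommGroup E] [NormedSpace ℝ E]

/-- `y` solves `ẏ = -V(y)`, `y(0) = y₀` on the time interval `[0, T]`. -/
def IsFlow (V : E → E) (y₀ : E) (T : ℝ) (y : ℝ → E) : Prop :=
  y 0 = y₀ ∧ ∀ t ∈ Icc 0 T, HasDerivWithinAt y (-V (y t)) (Icc 0 T) t

lemma exists_isFlow [ProperSpace E] {V : E → E} (hV : ContDiff ℝ 1 V) {y₀ : E} {M T : ℝ}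
    (hM : 0 ≤ M) (hb : ∀ x ∈ closedBall y₀ 1, ‖V x‖ ≤ M) (hT : 0 ≤ T) (hMT : M * T ≤ 1) :
    ∃ y, IsFlow V y₀ T y := by
  obtain ⟨K, hK⟩ := hV.neg.contDiffOn.exists_lipschitzOnWith one_ne_zero
    (convex_closedBall y₀ 1) (isCompact_closedBall y₀ 1)
  lift M to NNReal using hM
  have hPL : IsPicardLindelof (fun _ x => -V x) (⟨0, left_mem_Icc.2 hT⟩ : Icc (0 : ℝ) T) y₀ 1 0
      M K := by
    refine IsPicardLindelof.of_time_independent (fun x hx => ?_) hK ?_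
    · simpa using hb x hx
    · simpa [hT] using hMT
  obtain ⟨y, hy, hy'⟩ := hPL.exists_eq_forall_mem_Icc_hasDerivWithinAt₀
  exact ⟨y, hy, hy'⟩

/-- A solution cannot leave the unit ball around its initial point before time `1 / (M + 1)`, if the
field is bounded by `M` there. -/
lemma IsFlow.norm_sub_le {V : E → E} {y₀ : E} {M T : ℝ} {y : ℝ → E} (hy : IsFlow V y₀ T y)
    (hb : ∀ x ∈ closedBall y₀ 1, ‖V x‖ ≤ M) (hMT : (M + 1) * T ≤ 1) :
    ∀ t ∈ Icc 0 T, ‖y t - y₀‖ ≤ (M + 1) * t := by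
  have hM : 0 ≤ M := (norm_nonneg _).trans (hb y₀ (mem_closedBall_self zero_le_one))
  refine image_norm_le_of_norm_deriv_right_lt_deriv_boundary (f' := fun t => -V (y t))
    (B := fun t => (M + 1) * t) (B' := fun _ => M + 1)
    (fun t ht => ((hy.2 t ht).sub_const y₀).continuousWithinAt)
    (fun t ht => ((hy.2 t (Ico_subset_Icc_self ht)).sub_const y₀).mono_of_mem_nhdsWithin
      (Icc_mem_nhdsGE_of_mem ht)) (by simp [hy.1])
    (fun t => by simpa using (hasDerivAt_id t).const_mul (M + 1)) fun t ht h => ?_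
  have : y t ∈ closedBall y₀ 1 := by
    rw [mem_closedBall, dist_eq_norm, h]
    exact (mul_le_mul_of_nonneg_left ht.2.le (by linarith)).trans hMT
  rw [norm_neg]
  linarith [hb _ this]

/-- Expansion of the time-`τγ` map of the flow of `-(G + γ H + O(γ²))`, uniformly on balls and over
all fields within the given distance `C₀ γ²` of `G + γ H`. -/
lemma exists_flow_expansion [ProperSpace E] {G H : E → E} (hG : ContDiff ℝ 2 G)
    (hH : ContDiff ℝ 1 H) (R : ℝ) {τ C₀ : ℝ} (hτ : 0 ≤ τ) (hC₀ : 0 ≤ C₀) :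
    ∃ C, ∀ᶠ γ in 𝓝[>] (0 : ℝ), ∀ V : E → E, ContDiff ℝ 1 V →
      (∀ x ∈ closedBall (0 : E) (R + 1), ‖V x - (G x + γ • H x)‖ ≤ C₀ * γ ^ 2) →
      ∀ y₀ ∈ closedBall (0 : E) R, (∃ y, IsFlow V y₀ (τ * γ) y) ∧
        ∀ y, IsFlow V y₀ (τ * γ) y → (∀ t ∈ Icc 0 (τ * γ), y t ∈ closedBall (0 : E) (R + 1)) ∧
          ‖y (τ * γ) - (y₀ - γ • τ • G y₀ +
            γ ^ 2 • ((τ ^ 2 / 2) • fderiv ℝ G y₀ (G y₀) - τ • H y₀))‖ ≤ C * γ ^ 3 := by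
  set S := closedBall (0 : E) (R + 1)
  have hS : IsCompact S := isCompact_closedBall _ _
  have hSc : Convex ℝ S := convex_closedBall _ _
  have hDG : ContDiff ℝ 1 (fderiv ℝ G) := hG.fderiv_right (by norm_num)
  obtain ⟨MG, hMG⟩ := hS.exists_bound_of_continuousOn hG.continuous.continuousOn
  obtain ⟨MH, hMH⟩ := hS.exists_bound_of_continuousOn hH.continuous.continuousOn
  obtain ⟨D, hD⟩ := hS.exists_bound_of_continuousOn hDG.continuous.continuousOn
  obtain ⟨LG, hLG⟩ := hG.contDiffOn.exists_lipschitzOnWith (by norm_num) hSc hS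
  obtain ⟨LH, hLH⟩ := hH.contDiffOn.exists_lipschitzOnWith (by norm_num) hSc hS
  obtain ⟨K, hK⟩ := hDG.contDiffOn.exists_lipschitzOnWith (by norm_num) hSc hS
  set M := |MG| + |MH| + C₀ with hMdef
  have hM : 0 ≤ M := by positivity
  set C₁ := C₀ + |MH| + LG * ((M + 1) * τ)
  set C₂ := C₀ + LH * ((M + 1) * τ) + K * ((M + 1) * τ) ^ 2 + |D| * (C₁ * τ)
  have hC₁ : 0 ≤ C₁ := by positivity
  have hsmall : ∀ᶠ γ in 𝓝[>] (0 : ℝ), γ < min 1 (1 / ((M + 1) * τ + 1)) :=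
    (gt_mem_nhds (by positivity)).filter_mono nhdsWithin_le_nhds
  refine ⟨C₂ * τ, ?_⟩
  filter_upwards [hsmall, self_mem_nhdsWithin] with γ hγ (hγ0 : 0 < γ) V hV hVG y₀ hy₀
  have hγ1 : γ ≤ 1 := (hγ.trans_le (min_le_left _ _)).le
  have hγ2 : γ ^ 2 ≤ γ := by nlinarith
  have hMT : (M + 1) * (τ * γ) ≤ 1 := by
    have := hγ.trans_le (min_le_right _ _)
    rw [lt_div_iff₀ (by positivity)] at this
    nlinarith
  have hsub : closedBall y₀ 1 ⊆ S := closedBall_subset_closedBall' (by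
    rw [mem_closedBall] at hy₀
    linarith)
  have hy₀S : y₀ ∈ S := hsub (mem_closedBall_self zero_le_one)
  have hb : ∀ x ∈ closedBall y₀ 1, ‖V x‖ ≤ M := by
    intro x hx
    have hx := hsub hx
    calc ‖V x‖ = ‖(V x - (G x + γ • H x)) + (G x + γ • H x)‖ := by rw [sub_add_cancel]
      _ ≤ C₀ * γ ^ 2 + (|MG| + γ * |MH|) := by
          refine (norm_add_le _ _).trans (add_le_add (hVG x hx) ((norm_add_le _ _).trans ?_))
          rw [norm_smul, Real.norm_of_nonneg hγ0.le]
          gcongr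
          · exact (hMG x hx).trans (le_abs_self _)
          · exact (hMH x hx).trans (le_abs_self _)
      _ ≤ C₀ * 1 + (|MG| + 1 * |MH|) := by gcongr; linarith
      _ = M := by rw [hMdef]; ring
  have hT : 0 ≤ τ * γ := by positivity
  refine ⟨exists_isFlow hV hM hb hT (by nlinarith), fun y hy => ?_⟩
  have hnear := hy.norm_sub_le hb hMT
  have hnear' : ∀ t ∈ Icc 0 (τ * γ), ‖y t - y₀‖ ≤ (M + 1) * τ * γ := by
    intro t ht
    refine (hnear t ht).trans ?_
    rw [mul_assoc]
    exact mul_le_mul_of_nonneg_left ht.2 (by positivity)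
  have hyS : ∀ t ∈ Icc 0 (τ * γ), y t ∈ S := by
    intro t ht
    refine hsub ?_
    rw [mem_closedBall, dist_eq_norm]
    exact (hnear' t ht).trans (by rw [mul_assoc]; exact hMT)
  refine ⟨hyS, ?_⟩
  have hright : τ * γ ∈ Icc 0 (τ * γ) := right_mem_Icc.2 hT
  -- The solution moves along `-G y₀` up to second order.
  have hfirst : ∀ t ∈ Icc 0 (τ * γ), ‖y t - y₀ + t • G y₀‖ ≤ C₁ * τ * γ ^ 2 := by
    have hd : ∀ t ∈ Icc 0 (τ * γ), HasDerivWithinAt (fun t => y t + t • G y₀)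
        (-V (y t) + G y₀) (Icc 0 (τ * γ)) t := fun t ht => by
      simpa using! (hy.2 t ht).add ((hasDerivWithinAt_id t _).smul_const (G y₀))
    intro t ht
    have := norm_image_sub_le_of_norm_deriv_le_segment' (C := C₁ * γ) hd (fun t ht => ?_) t ht
    · simp only [zero_smul, add_zero, sub_zero, hy.1] at this
      rw [add_sub_right_comm] at this
      refine this.trans ?_
      calc C₁ * γ * t ≤ C₁ * γ * (τ * γ) := by gcongr; exact ht.2
        _ = _ := by ring
    · have ht := Ico_subset_Icc_self ht
      have e : -V (y t) + G y₀ = -(V (y t) - (G (y t) + γ • H (y t))) - γ • H (y t)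
          - (G (y t) - G y₀) := by abel
      rw [e]
      refine (norm_sub_le _ _).trans ((add_le_add ((norm_sub_le _ _).trans (add_le_add ?_ ?_))
        ?_).trans_eq (?_ : C₀ * γ + |MH| * γ + LG * ((M + 1) * τ * γ) = _))
      · rw [norm_neg]
        exact (hVG _ (hyS t ht)).trans (by gcongr)
      · rw [norm_smul, Real.norm_of_nonneg hγ0.le, mul_comm]
        gcongr
        exact (hMH _ (hyS t ht)).trans (le_abs_self _)
      · refine (hLG.norm_sub_le (hyS t ht) hy₀S).trans ?_
        gcongr
        exact hnear' t ht
      · ring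
  have hd : ∀ t ∈ Icc 0 (τ * γ), HasDerivWithinAt
      (fun t => y t + t • (G y₀ + γ • H y₀) - (t ^ 2 / 2) • fderiv ℝ G y₀ (G y₀))
      (-V (y t) + (G y₀ + γ • H y₀) - t • fderiv ℝ G y₀ (G y₀)) (Icc 0 (τ * γ)) t := fun t ht => by
    have h1 := (hy.2 t ht).add ((hasDerivWithinAt_id t _).smul_const (G y₀ + γ • H y₀))
    have h2 := (((hasDerivWithinAt_id t (Icc 0 (τ * γ))).pow 2).div_const 2).smul_const
      (fderiv ℝ G y₀ (G y₀))
    refine (h1.sub h2).congr_deriv ?_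
    simp
  have hsecond := norm_image_sub_le_of_norm_deriv_le_segment' (C := C₂ * γ ^ 2) hd
    (fun t ht => ?_) _ hright
  · rw [sub_zero, hy.1] at hsecond
    refine (le_of_eq ?_).trans (hsecond.trans_eq (by ring))
    congr 1
    module
  · have ht := Ico_subset_Icc_self ht
    have e : -V (y t) + (G y₀ + γ • H y₀) - t • fderiv ℝ G y₀ (G y₀) =
        -(V (y t) - (G (y t) + γ • H (y t))) - γ • (H (y t) - H y₀)
        - (G (y t) - G y₀ - fderiv ℝ G y₀ (y t - y₀))
        - fderiv ℝ G y₀ (y t - y₀ + t • G y₀) := by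
      simp only [map_add, map_sub, map_smul]
      module
    rw [e]
    refine (norm_sub_le _ _).trans ((add_le_add ((norm_sub_le _ _).trans (add_le_add
      ((norm_sub_le _ _).trans (add_le_add ?_ ?_)) ?_)) ?_).trans_eq
      (?_ : C₀ * γ ^ 2 + γ * (LH * ((M + 1) * τ * γ)) + K * ((M + 1) * τ * γ) ^ 2 +
        |D| * (C₁ * τ * γ ^ 2) = _))
    · rw [norm_neg]
      exact hVG _ (hyS t ht)
    · rw [norm_smul, Real.norm_of_nonneg hγ0.le]
      gcongr
      refine (hLH.norm_sub_le (hyS t ht) hy₀S).trans ?_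
      gcongr
      exact hnear' t ht
    · refine (norm_sub_sub_fderiv_le (hG.differentiable (by norm_num)) hSc hK hy₀S
        (hyS t ht)).trans ?_
      gcongr
      exact hnear' t ht
    · refine ((fderiv ℝ G y₀).le_opNorm _).trans ?_
      gcongr
      · exact (hD _ hy₀S).trans (le_abs_self _)
      · exact hfirst t ht
    · ring

end Flow

/-! ### Steering the flow by a constant field -/

section Shooting

open Metric

variable {E : Type*} [NormedAddCommGroup E] [NormedSpace ℝ E]

/-- For short times, changing the constant part `ε c` of the field to `ε c'` displaces the end
point of the flow by `-ε T (c - c')`, up to a relative error of `1 / 2`. -/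
lemma IsFlow.norm_sub_add_le {V : E → E} {S : Set E} {L : NNReal} (hL : LipschitzOnWith L V S)
    {y₀ c c' : E} {T ε : ℝ} (hT : 0 ≤ T) (hε : 0 < ε) (hLT : L * T ≤ 1 / 4) (hc : c ≠ c')
    {z z' : ℝ → E} (hz : IsFlow (fun x => V x + ε • c) y₀ T z)
    (hz' : IsFlow (fun x => V x + ε • c') y₀ T z')
    (hzS : ∀ t ∈ Icc 0 T, z t ∈ S) (hzS' : ∀ t ∈ Icc 0 T, z' t ∈ S) :
    ‖z T - z' T + (ε * T) • (c - c')‖ ≤ 1 / 2 * (ε * T * ‖c - c'‖) := by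
  set e := ε * ‖c - c'‖ with he_def
  have he : 0 < e := mul_pos hε (norm_pos_iff.2 (sub_ne_zero.2 hc))
  have hd : ∀ t ∈ Icc 0 T, HasDerivWithinAt (fun t => z t - z' t)
      (-(V (z t) - V (z' t)) - ε • (c - c')) (Icc 0 T) t := fun t ht =>
    ((hz.2 t ht).sub (hz'.2 t ht)).congr_deriv (by module)
  have hw : ∀ t ∈ Icc 0 T, ‖z t - z' t‖ ≤ 2 * e * t := by
    refine image_norm_le_of_norm_deriv_right_lt_deriv_boundary
      (f' := fun t => -(V (z t) - V (z' t)) - ε • (c - c'))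
      (B := fun t => 2 * e * t) (B' := fun _ => 2 * e)
      (fun t ht => (hd t ht).continuousWithinAt)
      (fun t ht => (hd t (Ico_subset_Icc_self ht)).mono_of_mem_nhdsWithin
        (Icc_mem_nhdsGE_of_mem ht)) (by simp [hz.1, hz'.1])
      (fun t => by simpa using (hasDerivAt_id t).const_mul (2 * e)) fun t ht h => ?_
    have ht' := Ico_subset_Icc_self ht
    have hV := hL.norm_sub_le (hzS t ht') (hzS' t ht')
    rw [h] at hV
    have : (L : ℝ) * (2 * e * t) ≤ 2 * e * (1 / 4) := by
      calc (L : ℝ) * (2 * e * t) = 2 * e * (L * t) := by ring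
        _ ≤ 2 * e * (L * T) := by gcongr; exact ht.2.le
        _ ≤ 2 * e * (1 / 4) := by gcongr
    calc ‖-(V (z t) - V (z' t)) - ε • (c - c')‖
        ≤ ‖V (z t) - V (z' t)‖ + e := by
          refine (_root_.norm_sub_le _ _).trans_eq ?_
          rw [norm_neg, norm_smul, Real.norm_of_nonneg hε.le]
      _ < 2 * e := by linarith
  have hd' : ∀ t ∈ Icc 0 T, HasDerivWithinAt (fun t => z t - z' t + (ε * t) • (c - c'))
      (-(V (z t) - V (z' t))) (Icc 0 T) t := fun t ht => by
    refine ((hd t ht).add ((((hasDerivWithinAt_id t (Icc 0 T)).const_mul ε).smul_const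
      (c - c')))).congr_deriv ?_
    simp
  have := norm_image_sub_le_of_norm_deriv_le_segment' (C := e / 2) hd' (fun t ht => ?_) T
    (right_mem_Icc.2 hT)
  · simp only [hz.1, hz'.1, mul_zero, zero_smul, sub_self, add_zero, sub_zero] at this
    exact this.trans_eq (by rw [he_def]; ring)
  · have ht' := Ico_subset_Icc_self ht
    rw [norm_neg]
    calc ‖V (z t) - V (z' t)‖ ≤ L * (2 * e * t) :=
          (hL.norm_sub_le (hzS t ht') (hzS' t ht')).trans (by gcongr; exact hw t ht')
      _ = 2 * e * (L * t) := by ring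
      _ ≤ 2 * e * (L * T) := by gcongr; exact ht.2.le
      _ ≤ 2 * e * (1 / 4) := by gcongr
      _ = e / 2 := by ring

/-- Over a short time, the flow of `-V` can be made to hit a nearby target exactly by adding a
constant `ε c` to the field. The constant is the fixed point of
`c ↦ c + (z_c(T) - target) / (ε T)`, where `z_c` is the flow of `-(V + ε c)`. -/
lemma exists_flow_eq_target [CompleteSpace E] {V : E → E} {S : Set E} {L : NNReal}
    (hL : LipschitzOnWith L V S) {y₀ target : E} {T ε ρ : ℝ} (hT : 0 < T) (hε : 0 < ε)
    (hρ : 0 ≤ ρ) (hLT : L * T ≤ 1 / 4)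
    (hex : ∀ c ∈ closedBall (0 : E) ρ, ∃ y, IsFlow (fun x => V x + ε • c) y₀ T y ∧
      ∀ t ∈ Icc 0 T, y t ∈ S)
    (h0 : ∀ y, IsFlow V y₀ T y → ‖y T - target‖ ≤ ε * T * (ρ / 2)) :
    ∃ c ∈ closedBall (0 : E) ρ, ∃ y, IsFlow (fun x => V x + ε • c) y₀ T y ∧ y T = target := by
  choose! z hz hzS using hex
  have hεT : 0 < ε * T := mul_pos hε hT
  set h : E → E := fun c => c + (ε * T)⁻¹ • (z c T - target) with h_def
  have hlip : ∀ c ∈ closedBall (0 : E) ρ, ∀ c' ∈ closedBall (0 : E) ρ,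
      ‖h c - h c'‖ ≤ 1 / 2 * ‖c - c'‖ := by
    intro c hc c' hc'
    rcases eq_or_ne c c' with rfl | hne
    · simp
    have key := IsFlow.norm_sub_add_le hL hT.le hε hLT hne (hz c hc) (hz c' hc') (hzS c hc)
      (hzS c' hc')
    have e : h c - h c' = (ε * T)⁻¹ • (z c T - z c' T + (ε * T) • (c - c')) := by
      rw [smul_add, inv_smul_smul₀ hεT.ne', h_def]
      module
    rw [e, norm_smul, norm_inv, Real.norm_of_nonneg hεT.le, inv_mul_le_iff₀ hεT]
    exact key.trans_eq (by ring)
  have hzero : (0 : E) ∈ closedBall (0 : E) ρ := mem_closedBall_self hρ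
  have hh0 : ‖h 0‖ ≤ ρ / 2 := by
    have := h0 (z 0) (by simpa using hz 0 hzero)
    rw [h_def]
    simp only [zero_add]
    rwa [norm_smul, norm_inv, Real.norm_of_nonneg hεT.le, inv_mul_le_iff₀ hεT]
  have hmaps : MapsTo h (closedBall 0 ρ) (closedBall 0 ρ) := by
    intro c hc
    have h1 := hlip c hc 0 hzero
    rw [mem_closedBall_zero_iff] at hc ⊢
    rw [sub_zero] at h1
    linarith [norm_le_norm_add_norm_sub (h 0) (h c), norm_sub_rev (h c) (h 0)]
  have hcontr : ContractingWith (1 / 2) (hmaps.restrict h _ _) := by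
    refine ⟨by norm_num, LipschitzWith.of_dist_le_mul fun c c' => ?_⟩
    simpa [Subtype.dist_eq, dist_eq_norm] using hlip c c.2 c' c'.2
  obtain ⟨c, hc, hfix, -⟩ := hcontr.exists_fixedPoint' isClosed_closedBall.isComplete hmaps hzero
    (edist_ne_top _ _)
  refine ⟨c, hc, z c, hz c hc, ?_⟩
  have : (ε * T)⁻¹ • (z c T - target) = 0 := by
    simpa [Function.IsFixedPt, h_def] using hfix
  rw [smul_eq_zero, or_iff_right (inv_ne_zero hεT.ne'), sub_eq_zero] at this
  exact this

end Shooting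

/-! ### The modified flow of Lookahead -/

section ModifiedFlow

open Metric

variable {ι : Type*} [Fintype ι] [DecidableEq ι] {E : Type*} [NormedAddCommGroup E]
  [InnerProductSpace ℝ E] [CompleteSpace E] {loss : ι → E → ℝ} {m b : ℕ}

lemma isGradientFlow_iff_isFlow {F : E → ℝ} {y₀ : E} {T : ℝ} {y : ℝ → E} :
    IsGradientFlow F y₀ T y ↔ IsFlow (gradient F) y₀ T y :=
  Iff.rfl

/-- The part of `∇(modifiedLoss)` of first order in the learning rate. -/
noncomputable def gradientCorrection (loss : ι → E → ℝ) (m b : ℕ) (k : ℕ → ℕ) (α : ℕ → ℝ) (n : ℕ)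
    (y : E) : E :=
  ((∏ q ∈ Finset.range n, α q) / 2) • meanInteraction loss m b 0 0 y
    - (interBatchWeight k α n / 2) • meanInteraction loss m b 0 1 y

lemma contDiff_gradientCorrection (hloss : ∀ s, ContDiff ℝ 3 (loss s)) (k : ℕ → ℕ) (α : ℕ → ℝ)
    (n : ℕ) : ContDiff ℝ 1 (gradientCorrection loss m b k α n) :=
  (contDiff_const.smul (contDiff_meanInteraction hloss 0 0)).sub
    (contDiff_const.smul (contDiff_meanInteraction hloss 0 1))

/-- The second-order coefficients of the modified flow over an epoch and of the mean epoch output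
agree. The `AN` part of the correction cancels the diagonal part of `D∇f ∇f`. -/
lemma second_order_eq (hloss : ∀ s, ContDiff ℝ 3 (loss s)) (hm : 0 < m)
    (hcard : Fintype.card ι = m * b) (k : ℕ → ℕ) (α : ℕ → ℝ) (n : ℕ) (y : E) :
    (((∏ q ∈ Finset.range n, α q) * m) ^ 2 / 2) •
        fderiv ℝ (gradient (fullLoss loss)) y (gradient (fullLoss loss) y)
      - ((∏ q ∈ Finset.range n, α q) * m) • gradientCorrection loss m b k α n y =
    ((∏ q ∈ Finset.range n, α q) * m * (interBatchWeight k α n +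
        (∏ q ∈ Finset.range n, α q) * (m - 1)) / 2) • meanInteraction loss m b 0 1 y := by
  have hm' : (m : ℝ) ≠ 0 := by positivity
  rw [fderiv_gradient_fullLoss hloss hm hcard, gradientCorrection]
  match_scalars
  · field_simp
    ring
  · field_simp
    ring

/-- The time-`βγm` map of the modified flow is the mean epoch output up to `O(γ³)`, uniformly over
balls and over all fields within distance `C₀ γ²` of the gradient of the modified loss. -/
lemma exists_bound_flow_sub_meanEpochOutput [ProperSpace E]
    (hloss : ∀ s, ContDiff ℝ 3 (loss s)) (hm : 0 < m) (hcard : Fintype.card ι = m * b)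
    (k : ℕ → ℕ) (α : ℕ → ℝ) (n : ℕ) (hdvd : (∏ q ∈ Finset.range n, k q) ∣ m)
    (hβ : 0 ≤ ∏ q ∈ Finset.range n, α q) (R : ℝ) {C₀ : ℝ} (hC₀ : 0 ≤ C₀) :
    ∃ C, ∀ᶠ γ in 𝓝[>] (0 : ℝ), ∀ V : E → E, ContDiff ℝ 1 V →
      (∀ x ∈ closedBall (0 : E) (R + 1),
        ‖V x - gradient (modifiedLoss loss m b k α n γ) x‖ ≤ C₀ * γ ^ 2) →
      ∀ y₀ ∈ closedBall (0 : E) R,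
        (∃ y, IsFlow V y₀ ((∏ q ∈ Finset.range n, α q) * γ * m) y) ∧
        ∀ y, IsFlow V y₀ ((∏ q ∈ Finset.range n, α q) * γ * m) y →
          (∀ t ∈ Icc 0 ((∏ q ∈ Finset.range n, α q) * γ * m), y t ∈ closedBall (0 : E) (R + 1)) ∧
          ‖y ((∏ q ∈ Finset.range n, α q) * γ * m) - meanEpochOutput loss m b γ k α n y₀‖
            ≤ C * γ ^ 3 := by
  set β := ∏ q ∈ Finset.range n, α q
  obtain ⟨C, hC⟩ := exists_flow_expansion
    (contDiff_gradient (contDiff_fullLoss hloss) (by norm_num : (2 : WithTop ℕ∞) + 1 ≤ 3))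
    (contDiff_gradientCorrection (m := m) (b := b) hloss k α n) R
    (mul_nonneg hβ (Nat.cast_nonneg m)) hC₀
  obtain ⟨C', hC'⟩ := (hasExpansion_meanEpochOutput hloss hm hcard k α n hdvd).exists_bound
    (isCompact_closedBall (0 : E) R)
  refine ⟨C + C', ?_⟩
  filter_upwards [hC, hC'] with γ hγ hγ' V hV hVP y₀ hy₀
  have hT : β * γ * m = β * m * γ := by ring
  obtain ⟨hex, hall⟩ := hγ V hV
    (fun x hx => by simpa only [gradient_modifiedLoss hloss] using! hVP x hx) y₀ hy₀
  rw [hT]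
  refine ⟨hex, fun y hy => ?_⟩
  obtain ⟨hyS, hbound⟩ := hall y hy
  refine ⟨hyS, ?_⟩
  rw [second_order_eq hloss hm hcard] at hbound
  rw [add_mul]
  exact (norm_sub_le_norm_sub_add_norm_sub _ _ _).trans
    (add_le_add hbound ((norm_sub_rev _ _).trans_le (hγ' y₀ hy₀)))

/-- A linear perturbation `γ² ⟨c, y⟩` with bounded `c` is admissible as an `O(γ²)` term, and adds the
constant field `γ² c` to the gradient. -/
lemma eqUpToSq_add_inner {P : ℝ → E → ℝ} (hP : ∀ γ, ContDiff ℝ 2 (P γ)) {c : ℝ → E} {ρ : ℝ}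
    (hc : ∀ γ, ‖c γ‖ ≤ ρ) : EqUpToSq (fun γ y => P γ y + γ ^ 2 * inner ℝ (c γ) y) P ∧
      ∀ γ, gradient (fun y => P γ y + γ ^ 2 * inner ℝ (c γ) y) =
        fun y => gradient (P γ) y + γ ^ 2 • c γ := by
  have hg : ∀ γ, gradient (fun y => P γ y + γ ^ 2 * inner ℝ (c γ) y) =
      fun y => gradient (P γ) y + γ ^ 2 • c γ := by
    intro γ
    refine gradient_eq fun y => hasGradientAt_add
      ((hP γ).differentiable (by norm_num) y).hasGradientAt (hasGradientAt_const_mul _ ?_)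
    rw [hasGradientAt_iff_hasFDerivAt]
    exact (InnerProductSpace.toDual ℝ E (c γ)).hasFDerivAt
  refine ⟨⟨fun γ _ => (hP γ).add (contDiff_const.mul (contDiff_const.inner ℝ contDiff_id)),
    fun K hK => ?_⟩, hg⟩
  obtain ⟨r, hr⟩ := hK.isBounded.exists_norm_le
  have hρ : 0 ≤ ρ := (norm_nonneg _).trans (hc 0)
  refine ⟨max (ρ * r) ρ, Eventually.of_forall fun γ y hy => ⟨?_, ?_⟩⟩
  · rw [add_sub_cancel_left, abs_mul, abs_of_nonneg (sq_nonneg γ), mul_comm]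
    gcongr
    exact ((abs_real_inner_le_norm _ _).trans
      (mul_le_mul (hc γ) (hr y hy) (norm_nonneg _) hρ)).trans (le_max_left _ _)
  · rw [hg, add_sub_cancel_left, norm_smul, Real.norm_of_nonneg (sq_nonneg γ), mul_comm]
    gcongr
    exact (hc γ).trans (le_max_right _ _)

/-- Some perturbation of the modified loss by a small linear function drives the flow from `y₀` to
the mean epoch output exactly, if the flow runs for a positive time. -/
lemma exists_linear_perturbation [ProperSpace E]
    (hloss : ∀ s, ContDiff ℝ 3 (loss s)) (hm : 0 < m) (hcard : Fintype.card ι = m * b)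
    (k : ℕ → ℕ) (α : ℕ → ℝ) (n : ℕ) (hdvd : (∏ q ∈ Finset.range n, k q) ∣ m)
    (hβ : 0 < ∏ q ∈ Finset.range n, α q) (y₀ : E) :
    ∃ ρ, 0 ≤ ρ ∧ ∀ᶠ γ in 𝓝[>] (0 : ℝ), ∃ c ∈ closedBall (0 : E) ρ, ∃ y,
      IsFlow (fun x => gradient (modifiedLoss loss m b k α n γ) x + γ ^ 2 • c) y₀
        ((∏ q ∈ Finset.range n, α q) * γ * m) y ∧
      y ((∏ q ∈ Finset.range n, α q) * γ * m) = meanEpochOutput loss m b γ k α n y₀ := by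
  have hV : ∀ γ, ContDiff ℝ 1 (gradient (modifiedLoss loss m b k α n γ)) := fun γ =>
    contDiff_gradient (contDiff_modifiedLoss hloss k α n γ) (by norm_num)
  obtain ⟨C, hC⟩ := exists_bound_flow_sub_meanEpochOutput (b := b) hloss hm hcard k α n hdvd hβ.le
    ‖y₀‖ le_rfl
  set β := ∏ q ∈ Finset.range n, α q
  have hm' : (0 : ℝ) < m := by positivity
  -- The target is missed by at most `C γ³`, which a constant field `γ² c` makes up for over the
  -- time `βγm`; the factor `2` allows for the contraction rate `1 / 2`.
  set ρ := 2 * |C| / (β * m) with hρ_def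
  have hρ : 0 ≤ ρ := by positivity
  obtain ⟨_, hD⟩ := exists_bound_flow_sub_meanEpochOutput (b := b) hloss hm hcard k α n hdvd hβ.le
    ‖y₀‖ hρ
  set S := closedBall (0 : E) (‖y₀‖ + 1)
  have hS : IsCompact S := isCompact_closedBall _ _
  have hSc : Convex ℝ S := convex_closedBall _ _
  obtain ⟨LG, hLG⟩ := (contDiff_gradient (contDiff_fullLoss hloss)
    (by norm_num : (2 : WithTop ℕ∞) + 1 ≤ 3)).contDiffOn.exists_lipschitzOnWith
      (by norm_num) hSc hS
  obtain ⟨LH, hLH⟩ := (contDiff_gradientCorrection (m := m) (b := b) hloss k α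
    n).contDiffOn.exists_lipschitzOnWith (by norm_num) hSc hS
  have hsmall : ∀ᶠ γ in 𝓝[>] (0 : ℝ), γ < min 1 (1 / (4 * ((LG + LH) * (β * m) + 1))) :=
    (gt_mem_nhds (by positivity)).filter_mono nhdsWithin_le_nhds
  refine ⟨ρ, hρ, ?_⟩
  filter_upwards [hC, hD, hsmall, self_mem_nhdsWithin] with γ hγC hγD hγ (hγ0 : 0 < γ)
  have hγ1 : γ ≤ 1 := (hγ.trans_le (min_le_left _ _)).le
  have hγ2 := hγ.trans_le (min_le_right _ _)
  rw [lt_div_iff₀ (by positivity)] at hγ2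
  have hL : LipschitzOnWith (LG + LH) (gradient (modifiedLoss loss m b k α n γ)) S := by
    refine LipschitzOnWith.of_dist_le_mul fun x hx x' hx' => ?_
    rw [gradient_modifiedLoss hloss, gradient_modifiedLoss hloss, dist_eq_norm, dist_eq_norm]
    have e : gradient (fullLoss loss) x + γ • gradientCorrection loss m b k α n x -
        (gradient (fullLoss loss) x' + γ • gradientCorrection loss m b k α n x') =
        (gradient (fullLoss loss) x - gradient (fullLoss loss) x') +
        γ • (gradientCorrection loss m b k α n x - gradientCorrection loss m b k α n x') := by
      module
    refine (congrArg norm e).trans_le ((norm_add_le _ _).trans ?_)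
    rw [norm_smul, Real.norm_of_nonneg hγ0.le, NNReal.coe_add, add_mul]
    refine add_le_add (hLG.norm_sub_le hx hx') ?_
    exact (mul_le_of_le_one_left (norm_nonneg _) hγ1).trans (hLH.norm_sub_le hx hx')
  have hy₀ : y₀ ∈ closedBall (0 : E) ‖y₀‖ := by simp
  refine exists_flow_eq_target hL (by positivity) (by positivity) hρ ?_ (fun c hc => ?_)
    fun y hy => ?_
  · rw [NNReal.coe_add]
    nlinarith
  · obtain ⟨⟨y, hy⟩, hall⟩ := hγD
      (fun x => gradient (modifiedLoss loss m b k α n γ) x + γ ^ 2 • c)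
      ((hV γ).add contDiff_const) (fun x _ => by
      rw [add_sub_cancel_left, norm_smul, Real.norm_of_nonneg (sq_nonneg γ), mul_comm]
      exact mul_le_mul_of_nonneg_right (mem_closedBall_zero_iff.1 hc) (sq_nonneg γ)) y₀ hy₀
    exact ⟨y, hy, (hall y hy).1⟩
  · refine (((hγC _ (hV γ) (by simp) y₀ hy₀).2 y hy).2).trans ?_
    have : γ ^ 2 * (β * γ * m) * (ρ / 2) = |C| * γ ^ 3 := by
      rw [hρ_def]
      field_simp
    rw [this]
    gcongr
    exact le_abs_self C

end ModifiedFlow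

end Lookahead

theorem mainTheorem3 {d : ℕ} {ι : Type*} [Fintype ι] [DecidableEq ι]
    (loss : ι → EuclideanSpace ℝ (Fin d) → ℝ) (hloss : ∀ s, ContDiff ℝ 3 (loss s))
    (m b : ℕ) (hm : 0 < m) (hb : 0 < b) (hcard : Fintype.card ι = m * b)
    (n : ℕ) (k : ℕ → ℕ) (α : ℕ → ℝ) (hα : ∀ p < n, 0 ≤ α p ∧ α p ≤ 1)
    (hdvd : (∏ q ∈ Finset.range n, k q) ∣ m) :
    (∀ F : ℝ → EuclideanSpace ℝ (Fin d) → ℝ,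
      Lookahead.EqUpToSq F (Lookahead.modifiedLoss loss m b k α n) →
      ∀ K : Set (EuclideanSpace ℝ (Fin d)), IsCompact K →
      ∃ C : ℝ, ∀ᶠ γ in 𝓝[>] (0 : ℝ), ∀ y₀ ∈ K,
        (∃ y, Lookahead.IsGradientFlow (F γ) y₀ ((∏ q ∈ Finset.range n, α q) * γ * m) y) ∧
        ∀ y, Lookahead.IsGradientFlow (F γ) y₀ ((∏ q ∈ Finset.range n, α q) * γ * m) y →
          ‖y ((∏ q ∈ Finset.range n, α q) * γ * m)
            - Lookahead.meanEpochOutput loss m b γ k α n y₀‖ ≤ C * γ ^ 3) ∧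
    (∀ y₀ : EuclideanSpace ℝ (Fin d), ∃ F : ℝ → EuclideanSpace ℝ (Fin d) → ℝ,
      Lookahead.EqUpToSq F (Lookahead.modifiedLoss loss m b k α n) ∧
      ∀ᶠ γ in 𝓝[>] (0 : ℝ), ∃ y,
        Lookahead.IsGradientFlow (F γ) y₀ ((∏ q ∈ Finset.range n, α q) * γ * m) y ∧
        y ((∏ q ∈ Finset.range n, α q) * γ * m)
          = Lookahead.meanEpochOutput loss m b γ k α n y₀) := by
  have hβ : 0 ≤ ∏ q ∈ Finset.range n, α q :=
    Finset.prod_nonneg fun q hq => (hα q (Finset.mem_range.1 hq)).1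
  refine ⟨fun F hF K hK => ?_, fun y₀ => ?_⟩
  · obtain ⟨R, hR⟩ := hK.isBounded.exists_norm_le
    obtain ⟨C₀, hC₀⟩ := hF.2 _ (isCompact_closedBall 0 (R + 1))
    obtain ⟨C, hC⟩ := Lookahead.exists_bound_flow_sub_meanEpochOutput (b := b) hloss hm hcard k α n
      hdvd hβ R (abs_nonneg C₀)
    refine ⟨C, ?_⟩
    filter_upwards [hC, hC₀, self_mem_nhdsWithin] with γ hγ hγ₀ (hpos : 0 < γ) y₀ hy₀
    obtain ⟨hex, hall⟩ := hγ (gradient (F γ))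
      (Lookahead.contDiff_gradient (hF.1 γ hpos) (by norm_num))
      (fun x hx => (hγ₀ x hx).2.trans (by gcongr; exact le_abs_self C₀)) y₀
      (mem_closedBall_zero_iff.2 (hR y₀ hy₀))
    exact ⟨hex, fun y hy => (hall y hy).2⟩
  · have hP := Lookahead.contDiff_modifiedLoss (m := m) (b := b) hloss k α n
    rcases hβ.eq_or_lt with h0 | hβ
    · -- The epoch leaves `y₀` fixed, and the flow runs for no time.
      refine ⟨Lookahead.modifiedLoss loss m b k α n, ⟨fun γ _ => hP γ, fun K _ => ⟨0, by simp⟩⟩,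
        Eventually.of_forall fun γ => ⟨fun _ => y₀, ⟨rfl, fun t ht => ?_⟩, ?_⟩⟩
      · rw [← h0, zero_mul, zero_mul, Icc_self] at ht ⊢
        exact HasFDerivWithinAt.singleton
      · obtain ⟨hc, -⟩ := Lookahead.card_smul_shuffleMean
          (V := EuclideanSpace ℝ (Fin d)) hcard 0
        simp only [Lookahead.meanEpochOutput, Lookahead.output_eq_self _ _ _ h0.symm,
          Lookahead.shuffleMean, Finset.sum_const, Finset.card_univ, ← Nat.cast_smul_eq_nsmul ℝ]
        rw [inv_smul_smul₀ hc]
    · obtain ⟨ρ, hρ, h⟩ := Lookahead.exists_linear_perturbation (b := b) hloss hm hcard k α n hdvd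
        hβ y₀
      -- A bounded choice of the perturbation for all learning rates, `0` where none is needed.
      have hchoice : ∀ γ : ℝ, ∃ c : EuclideanSpace ℝ (Fin d), ‖c‖ ≤ ρ ∧
          ((∃ c ∈ Metric.closedBall (0 : EuclideanSpace ℝ (Fin d)) ρ, ∃ y, Lookahead.IsFlow
            (fun x => gradient (Lookahead.modifiedLoss loss m b k α n γ) x + γ ^ 2 • c) y₀
              ((∏ q ∈ Finset.range n, α q) * γ * m) y ∧
            y ((∏ q ∈ Finset.range n, α q) * γ * m)
              = Lookahead.meanEpochOutput loss m b γ k α n y₀) →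
          ∃ y, Lookahead.IsFlow
            (fun x => gradient (Lookahead.modifiedLoss loss m b k α n γ) x + γ ^ 2 • c) y₀
              ((∏ q ∈ Finset.range n, α q) * γ * m) y ∧
            y ((∏ q ∈ Finset.range n, α q) * γ * m)
              = Lookahead.meanEpochOutput loss m b γ k α n y₀) := by
        intro γ
        by_cases hc : ∃ c ∈ Metric.closedBall (0 : EuclideanSpace ℝ (Fin d)) ρ, ∃ y,
          Lookahead.IsFlow
            (fun x => gradient (Lookahead.modifiedLoss loss m b k α n γ) x + γ ^ 2 • c) y₀
              ((∏ q ∈ Finset.range n, α q) * γ * m) y ∧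
            y ((∏ q ∈ Finset.range n, α q) * γ * m)
              = Lookahead.meanEpochOutput loss m b γ k α n y₀
        · obtain ⟨c, hc, hy⟩ := hc
          exact ⟨c, mem_closedBall_zero_iff.1 hc, fun _ => hy⟩
        · exact ⟨0, by simpa using hρ, fun h => absurd h hc⟩
      choose c hcρ hc using hchoice
      obtain ⟨hF, hgrad⟩ := Lookahead.eqUpToSq_add_inner hP hcρ
      refine ⟨_, hF, h.mono fun γ hγ => ?_⟩
      simp only [Lookahead.isGradientFlow_iff_isFlow, hgrad]
      exact hc γ hγ
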